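/- Let $N\ge 2$, let $R>0$, and let $B_R$ be the open ball of centre $0$ and radius $R$ in $\mathbb R^N$. Let $g:\mathbb R\to\mathbb R$ be locally Lipschitz continuous, and suppose that for some $a>0$ the function $g$ is positive and convex on $[a,\infty)$ and satisfies the Keller–Osserman condition $$\int_a^{\infty}\frac{dt}{\sqrt{G(t)}}<\infty,\qquad G(t)=\int_a^t g(s)\,ds .$$ Let $u\in C^2(B_R)$ satisfy $-\Delta u+g(u)=0$ in $B_R$ and $u(x)\to\infty$ uniformly as $|x|\to R$. Then $u$ is radially symmetric, that is, $u(x)$ depends only on $|x|$, and $$\frac{\partial u}{\partial r}(x)=\Big\langle \nabla u(x),\frac{x}{|x|}\Big\rangle>0\qquad\text{for all } x\in B_R\setminus\{0\}.$$ -/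

import Mathlib

open MeasureTheory Set Filter Topology
open scoped Gradient Laplacian

/-- The primitive `G(t) = ∫_a^t g(s) ds`. -/
noncomputable def primitiveFrom (g : ℝ → ℝ) (a t : ℝ) : ℝ :=
  ∫ s in a..t, g s

/-- The Keller-Osserman condition: `∫_a^∞ dt / √G(t) < ∞`, where `G(t) = ∫_a^t g(s) ds`. -/
def KellerOsserman (g : ℝ → ℝ) (a : ℝ) : Prop :=
  IntegrableOn (fun t : ℝ => 1 / √(primitiveFrom g a t)) (Ioi a) volume

/-- `u` is a large solution of `-Δu + g(u) = 0` in the open ball `B_R` of `ℝ^N`: it is of class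
`C²` in `B_R`, it solves the equation at every point of `B_R`, and `u(x) → ∞` uniformly as
`|x| → R` from inside the ball. Values of `u` outside `B_R` are irrelevant. -/
structure IsLargeSolution {N : ℕ} (g : ℝ → ℝ) (R : ℝ)
    (u : EuclideanSpace ℝ (Fin N) → ℝ) : Prop where
  contDiffOn : ContDiffOn ℝ 2 u (Metric.ball 0 R)
  equation : ∀ x ∈ Metric.ball (0 : EuclideanSpace ℝ (Fin N)) R, -(Δ u) x + g (u x) = 0
  blowup : ∀ M : ℝ, ∃ δ > 0, ∀ x ∈ Metric.ball (0 : EuclideanSpace ℝ (Fin N)) R,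
    R - δ < ‖x‖ → M < u x

/-- The radial derivative `∂u/∂r (x) = ⟨∇u(x), x/|x|⟩` (meant for `x ≠ 0`). -/
noncomputable def radialDeriv {N : ℕ} (u : EuclideanSpace ℝ (Fin N) → ℝ)
    (x : EuclideanSpace ℝ (Fin N)) : ℝ :=
  inner ℝ (∇ u x) (‖x‖⁻¹ • x)

/-- `u` is radially symmetric in `B_R`: for `x ∈ B_R` the value `u x` depends only on `|x|`. -/
def IsRadialOnBall {N : ℕ} (R : ℝ) (u : EuclideanSpace ℝ (Fin N) → ℝ) : Prop :=
  ∀ x ∈ Metric.ball (0 : EuclideanSpace ℝ (Fin N)) R,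
    ∀ y ∈ Metric.ball (0 : EuclideanSpace ℝ (Fin N)) R, ‖x‖ = ‖y‖ → u x = u y

/-!
The proof combines the method of moving planes with precise boundary asymptotics.

*Moving planes.* For a unit vector `e` and `l > 0`, compare `u` with its reflection in the plane
`⟪e, x⟫ = l` on the cap `{⟪e, x⟫ > l}` of the ball. The difference `w = u - u ∘ reflection`
satisfies `Δw = c w`, but `w` has no boundary values on the spherical part of the cap, where both
terms may be infinite. The remedy is `AlmostRadiallyMonotone`: near the sphere `u` is increasing in
`|x|`, uniformly in the direction, up to an arbitrarily small error, and hence `w ≥ -ε` there. Since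
`g` is increasing on the large values that `u` takes near the sphere, the maximum principle holds on
the part of the cap near the sphere and, in the rest of it, on narrow strips along the plane
(`exists_strip_width`). The plane can therefore be moved from `l = R` to every `l > 0`
(`planeReflection_le`). The limit `l → 0` gives the symmetry of `u` in every plane through the
centre, and Hopf's lemma at `x`, applied with the plane through `x` orthogonal to `x`, gives the
sign of the radial derivative.

*Boundary asymptotics.* Convexity and the Keller-Osserman condition give `g t / √(G t) → ∞`, and a
radial solution `V` near the sphere, blowing up exactly there: as a function of its value `t` the
radius solves an integral equation, which is a contraction for large `t` (`exists_phaseCurve`).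
Adding a constant `E` to the squared slope of `V` produces subsolutions `V₂ < V` that blow up on the
same sphere, have `V - V₂ → 0`, and start as close to the sphere as desired if `E` is large.
Comparison with dilations about the radius `2R`, which move the blow-up off the sphere, shows `V₂ ≤
u` (`profile_le`). By convexity of `g`, the function `V + A (V - V₂)` is a supersolution for every
`A ≥ 0`, and for large `A` it is above `u` on a sphere inside the ball; so `u ≤ V + A (V - V₂)`
(`le_profile`). Consequently `u - V → 0` at the sphere, and as `V` is radially increasing, `u` is
almost radially monotone (`almostRadiallyMonotone`).
-/


/-! ### Second derivatives along lines and the Laplacian at a touching point -/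

/-- `h` is differentiable near `x` and its derivative has derivative `c` at `x`. -/
def HasSecondDerivAt (h : ℝ → ℝ) (c x : ℝ) : Prop :=
  ∃ h1 : ℝ → ℝ, (∀ᶠ s in 𝓝 x, HasDerivAt h (h1 s) s) ∧ HasDerivAt h1 c x

theorem HasSecondDerivAt.deriv_deriv {h : ℝ → ℝ} {c x : ℝ} (hh : HasSecondDerivAt h c x) :
    deriv (deriv h) x = c := by
  obtain ⟨h1, e, d⟩ := hh
  have : deriv h =ᶠ[𝓝 x] h1 := e.mono fun s hs => hs.deriv
  rw [this.deriv_eq, d.deriv]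

theorem HasSecondDerivAt.unique {h : ℝ → ℝ} {c c' x : ℝ} (hh : HasSecondDerivAt h c x)
    (hh' : HasSecondDerivAt h c' x) : c = c' := by
  rw [← hh.deriv_deriv, ← hh'.deriv_deriv]

theorem HasSecondDerivAt.sub {h k : ℝ → ℝ} {c c' x : ℝ} (hh : HasSecondDerivAt h c x)
    (hk : HasSecondDerivAt k c' x) : HasSecondDerivAt (fun s => h s - k s) (c - c') x := by
  obtain ⟨h1, e, d⟩ := hh
  obtain ⟨k1, e', d'⟩ := hk
  exact ⟨fun s => h1 s - k1 s, (e.and e').mono fun s hs => hs.1.sub hs.2, d.sub d'⟩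

/-- The second-order necessary condition for a local minimum. -/
theorem HasSecondDerivAt.nonneg_of_isLocalMin {h : ℝ → ℝ} {c x : ℝ}
    (hh : HasSecondDerivAt h c x) (hmin : IsLocalMin h x) : 0 ≤ c := by
  by_contra! hc
  have hmax : IsLocalMax h x := by
    refine isLocalMax_of_deriv_deriv_neg (by rwa [hh.deriv_deriv]) hmin.deriv_eq_zero ?_
    obtain ⟨h1, e, d⟩ := hh
    exact e.self_of_nhds.continuousAt
  have hconst : h =ᶠ[𝓝 x] fun _ => h x := by
    filter_upwards [hmin, hmax] with s h1 h2 using le_antisymm h2 h1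
  have h0 : deriv h =ᶠ[𝓝 x] fun _ => 0 := by
    filter_upwards [hconst.eventuallyEq_nhds] with s hs
    rw [hs.deriv_eq, deriv_const]
  have : deriv (deriv h) x = 0 := by rw [h0.deriv_eq, deriv_const]
  rw [hh.deriv_deriv] at this
  exact hc.ne this

section Euclidean

variable {N : ℕ}

theorem hasSecondDerivAt_line {f : EuclideanSpace ℝ (Fin N) → ℝ} {x : EuclideanSpace ℝ (Fin N)}
    (hf : ContDiffAt ℝ 2 f x) (v : EuclideanSpace ℝ (Fin N)) :
    HasSecondDerivAt (fun s : ℝ => f (x + s • v)) (iteratedFDeriv ℝ 2 f x ![v, v]) 0 := by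
  have hl : ∀ s : ℝ, HasDerivAt (fun s : ℝ => x + s • v) v s := fun s => by
    simpa using ((hasDerivAt_id s).smul_const v).const_add x
  have hl0 : Tendsto (fun s : ℝ => x + s • v) (𝓝 0) (𝓝 x) := by
    simpa using (hl 0).continuousAt.tendsto
  refine ⟨fun s => fderiv ℝ f (x + s • v) v, ?_, ?_⟩
  · have h1 : ∀ᶠ y in 𝓝 x, ContDiffAt ℝ 2 f y := hf.eventually (by simp)
    filter_upwards [hl0.eventually h1] with s hs
    exact ((hs.differentiableAt (by simp)).hasFDerivAt).comp_hasDerivAt s (hl s)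
  · have h2 : DifferentiableAt ℝ (fderiv ℝ f) x :=
      (hf.fderiv_right (m := 1) (by norm_num)).differentiableAt (by simp)
    have h3 : HasFDerivAt (fderiv ℝ f) (fderiv ℝ (fderiv ℝ f) x) (x + (0 : ℝ) • v) := by
      simpa using h2.hasFDerivAt
    have h4 : HasDerivAt (fun s : ℝ => fderiv ℝ f (x + s • v)) (fderiv ℝ (fderiv ℝ f) x v) 0 :=
      h3.comp_hasDerivAt (0 : ℝ) (hl 0)
    have h5 := h4.clm_apply (hasDerivAt_const (0 : ℝ) v)
    rw [iteratedFDeriv_two_apply]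
    simpa using h5

theorem laplacian_eq_sum_of_hasSecondDerivAt {f : EuclideanSpace ℝ (Fin N) → ℝ}
    {x : EuclideanSpace ℝ (Fin N)} (hf : ContDiffAt ℝ 2 f x)
    (v : OrthonormalBasis (Fin N) ℝ (EuclideanSpace ℝ (Fin N))) {d : Fin N → ℝ}
    (hd : ∀ i, HasSecondDerivAt (fun s : ℝ => f (x + s • v i)) (d i) 0) :
    (Δ f) x = ∑ i, d i := by
  rw [InnerProductSpace.laplacian_eq_iteratedFDeriv_orthonormalBasis f v]
  exact Finset.sum_congr rfl fun i _ => (hasSecondDerivAt_line hf (v i)).unique (hd i)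

/-- If `f - ψ` has a local minimum at `x`, then `Δψ ≤ Δf` there, where `Δψ` is computed along the
lines of an orthonormal basis only, so that no regularity of `ψ` as a function of several variables
is needed. -/
theorem sum_le_laplacian_of_isLocalMin {f ψ : EuclideanSpace ℝ (Fin N) → ℝ}
    {x : EuclideanSpace ℝ (Fin N)} (hf : ContDiffAt ℝ 2 f x)
    (v : OrthonormalBasis (Fin N) ℝ (EuclideanSpace ℝ (Fin N))) {d : Fin N → ℝ}
    (hd : ∀ i, HasSecondDerivAt (fun s : ℝ => ψ (x + s • v i)) (d i) 0)
    (hmin : IsLocalMin (fun y => f y - ψ y) x) :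
    ∑ i, d i ≤ (Δ f) x := by
  rw [laplacian_eq_sum_of_hasSecondDerivAt hf v fun i => hasSecondDerivAt_line hf (v i)]
  refine Finset.sum_le_sum fun i _ => ?_
  have hl0 : ContinuousAt (fun s : ℝ => x + s • v i) 0 := by fun_prop
  have h1 : IsLocalMin (fun s : ℝ => f (x + s • v i) - ψ (x + s • v i)) 0 := by
    have : Tendsto (fun s : ℝ => x + s • v i) (𝓝 0) (𝓝 x) := by simpa using hl0.tendsto
    have := this.eventually hmin
    simpa [IsLocalMin, IsMinFilter] using this
  have := ((hasSecondDerivAt_line hf (v i)).sub (hd i)).nonneg_of_isLocalMin h1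
  linarith

theorem exists_orthonormalBasis_apply_eq (hN : 0 < N) {e : EuclideanSpace ℝ (Fin N)}
    (he : ‖e‖ = 1) :
    ∃ v : OrthonormalBasis (Fin N) ℝ (EuclideanSpace ℝ (Fin N)), v ⟨0, hN⟩ = e := by
  have h : Orthonormal ℝ (({(⟨0, hN⟩ : Fin N)} : Set (Fin N)).domRestrict fun _ => e) := by
    constructor
    · intro i; exact he
    · intro i j hij; exact absurd (Subsingleton.elim i j) hij
  obtain ⟨b, hb⟩ := h.exists_orthonormalBasis_extension_of_card_eq (by simp)
  exact ⟨b, hb _ (by simp)⟩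

theorem norm_add_smul_of_inner_eq_zero {z v : EuclideanSpace ℝ (Fin N)} (hv : ‖v‖ = 1)
    (hzv : inner ℝ z v = 0) (s : ℝ) : ‖z + s • v‖ = √(‖z‖ ^ 2 + s ^ 2) := by
  rw [eq_comm, Real.sqrt_eq_iff_mul_self_eq (by positivity) (norm_nonneg _),
    norm_add_mul_self_real, inner_smul_right, hzv, norm_smul, hv]
  simp [pow_two]

/-- A radial function has second derivative `φ'(r) / r` in the directions tangent to the sphere,
along which the distance to the centre is `√(r² + s²)`. -/
theorem hasSecondDerivAt_radial_perp {φ φ1 : ℝ → ℝ} {c r : ℝ} (hr : 0 < r)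
    (h1 : ∀ᶠ s in 𝓝 r, HasDerivAt φ (φ1 s) s) (h2 : HasDerivAt φ1 c r) :
    HasSecondDerivAt (fun s => φ (√(r ^ 2 + s ^ 2))) (φ1 r / r) 0 := by
  have hq : ∀ s, HasDerivAt (fun s : ℝ => √(r ^ 2 + s ^ 2)) (s / √(r ^ 2 + s ^ 2)) s := fun s => by
    have h := ((hasDerivAt_pow 2 s).const_add (r ^ 2)).sqrt (by positivity)
    convert h using 1
    field_simp
    push_cast
    ring
  have hq0 : √(r ^ 2 + (0 : ℝ) ^ 2) = r := by simp [Real.sqrt_sq hr.le]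
  refine ⟨fun s => φ1 (√(r ^ 2 + s ^ 2)) * (s / √(r ^ 2 + s ^ 2)), ?_, ?_⟩
  · have : Tendsto (fun s : ℝ => √(r ^ 2 + s ^ 2)) (𝓝 0) (𝓝 r) := by
      have := (hq 0).continuousAt.tendsto
      rwa [hq0] at this
    filter_upwards [this.eventually h1] with s hs
    exact hs.comp s (hq s)
  · have ha : HasDerivAt (fun s => φ1 (√(r ^ 2 + s ^ 2))) (c * (0 / √(r ^ 2 + (0 : ℝ) ^ 2))) 0 := by
      refine HasDerivAt.comp (0 : ℝ) (h₂ := φ1) ?_ (hq 0)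
      rwa [hq0]
    have hb := (hasDerivAt_id (0 : ℝ)).div (hq 0) (by rw [hq0]; exact hr.ne')
    refine (ha.mul hb).congr_deriv ?_
    simp only [hq0, id]
    field_simp
    simp [mul_comm]

/-- A radial function has second derivative `φ''(r)` in the radial direction; the absolute value
comes from `‖(r + s) • e‖ = |r + s|`. -/
theorem hasSecondDerivAt_radial_normal {φ φ1 : ℝ → ℝ} {c r : ℝ} (hr : 0 < r)
    (h1 : ∀ᶠ s in 𝓝 r, HasDerivAt φ (φ1 s) s) (h2 : HasDerivAt φ1 c r) :
    HasSecondDerivAt (fun s => φ |r + s|) c 0 := by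
  have ht : Tendsto (fun s : ℝ => r + s) (𝓝 0) (𝓝 r) := by
    have : ContinuousAt (fun s : ℝ => r + s) 0 := by fun_prop
    simpa using this.tendsto
  have hpos : ∀ᶠ s in 𝓝 (0 : ℝ), 0 < r + s := ht.eventually (lt_mem_nhds hr)
  refine ⟨fun s => φ1 (r + s), ?_, ?_⟩
  · filter_upwards [ht.eventually h1, hpos.eventually_nhds] with s hs hp
    have : HasDerivAt (fun s => φ (r + s)) (φ1 (r + s)) s := HasDerivAt.comp_const_add r s hs
    refine this.congr_of_eventuallyEq ?_
    filter_upwards [hp] with t ht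
    rw [abs_of_pos ht]
  · exact HasDerivAt.comp_const_add r 0 (by simpa using h2)

/-- A radial function touching `f` from below at `x` has Laplacian `φ'' + (N - 1) φ' / r` at most
`Δf` there. All comparison arguments below use this form of the maximum principle. -/
theorem radial_le_laplacian_of_isLocalMin (hN : 0 < N) {f : EuclideanSpace ℝ (Fin N) → ℝ}
    {x y : EuclideanSpace ℝ (Fin N)} (hf : ContDiffAt ℝ 2 f x) (hxy : x ≠ y)
    {φ φ1 : ℝ → ℝ} {c : ℝ} (h1 : ∀ᶠ s in 𝓝 ‖x - y‖, HasDerivAt φ (φ1 s) s)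
    (h2 : HasDerivAt φ1 c ‖x - y‖)
    (hmin : IsLocalMin (fun z => f z - φ ‖z - y‖) x) :
    c + (N - 1) * (φ1 ‖x - y‖ / ‖x - y‖) ≤ (Δ f) x := by
  set r := ‖x - y‖ with hr_def
  have hr : 0 < r := norm_pos_iff.2 (sub_ne_zero.2 hxy)
  set e : EuclideanSpace ℝ (Fin N) := r⁻¹ • (x - y) with he_def
  have he : ‖e‖ = 1 := by
    rw [he_def, norm_smul, ← hr_def, Real.norm_of_nonneg (by positivity)]; field_simp
  have hxe : x - y = r • e := by rw [he_def, smul_smul]; field_simp; simp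
  obtain ⟨v, hv⟩ := exists_orthonormalBasis_apply_eq hN he
  have key := sum_le_laplacian_of_isLocalMin (ψ := fun z => φ ‖z - y‖) hf v
    (d := fun i => if i = ⟨0, hN⟩ then c else φ1 r / r) ?_ hmin
  · rw [Fintype.sum_eq_add_sum_compl ⟨0, hN⟩, if_pos rfl,
      Finset.sum_congr rfl fun i hi => if_neg (by simpa using hi)] at key
    simpa [Finset.card_compl, Nat.cast_sub (Nat.one_le_iff_ne_zero.2 hN.ne')] using key
  · intro i
    split_ifs with hi
    · subst hi
      have : (fun s : ℝ => φ ‖x + s • v ⟨0, hN⟩ - y‖) = fun s => φ |r + s| := by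
        funext s
        rw [hv, add_sub_right_comm, hxe, ← add_smul, norm_smul, he, mul_one, Real.norm_eq_abs]
      rw [this]
      exact hasSecondDerivAt_radial_normal hr h1 h2
    · have hperp : inner ℝ (x - y) (v i) = 0 := by
        rw [hxe, inner_smul_left, ← hv, v.orthonormal.2 (Ne.symm hi), mul_zero]
      have : (fun s : ℝ => φ ‖x + s • v i - y‖) = fun s => φ (√(r ^ 2 + s ^ 2)) := by
        funext s
        rw [add_sub_right_comm, norm_add_smul_of_inner_eq_zero (v.orthonormal.1 i) hperp]
      rw [this]
      exact hasSecondDerivAt_radial_perp hr h1 h2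

/-- The Laplacian commutes with affine isometries. -/
theorem laplacian_comp_affineIsometry {f : EuclideanSpace ℝ (Fin N) → ℝ}
    {x : EuclideanSpace ℝ (Fin N)}
    (L : EuclideanSpace ℝ (Fin N) ≃ₗᵢ[ℝ] EuclideanSpace ℝ (Fin N)) (a : EuclideanSpace ℝ (Fin N))
    (hf : ContDiffAt ℝ 2 f (L x + a)) :
    (Δ fun z => f (L z + a)) x = (Δ f) (L x + a) := by
  set v := EuclideanSpace.basisFun (Fin N) ℝ
  have hL : ContDiffAt ℝ 2 (fun z => L z + a) x := by
    have := L.contDiff (n := 2)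
    fun_prop
  have hc : ContDiffAt ℝ 2 (fun z => f (L z + a)) x := hf.comp x hL
  rw [laplacian_eq_sum_of_hasSecondDerivAt hf (v.map L)
    fun i => hasSecondDerivAt_line hf ((v.map L) i)]
  refine laplacian_eq_sum_of_hasSecondDerivAt hc v fun i => ?_
  have := hasSecondDerivAt_line hf ((v.map L) i)
  have h2 : (fun s : ℝ => f (L (x + s • v i) + a)) = fun s : ℝ => f (L x + a + s • (v.map L) i) := by
    funext s
    simp [add_right_comm]
  rwa [h2]

end Euclidean

/-! ### Hopf's lemma and the strong maximum principle -/

section Hopf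

variable {N : ℕ} {w : EuclideanSpace ℝ (Fin N) → ℝ} {y x₀ : EuclideanSpace ℝ (Fin N)} {ρ K : ℝ}

/-- The barrier in the proof of Hopf's lemma: a positive solution of `Δw ≤ K w` in a ball lies above
a small multiple of `exp (-α|x - y|²) - exp (-αρ²)` in the annulus `ρ/2 ≤ |x - y| ≤ ρ`. -/
theorem exists_barrier_le_of_laplacian_le (hN : 0 < N) (hρ : 0 < ρ) (hK : 0 ≤ K)
    (hcont : ContinuousOn w (Metric.closedBall y ρ))
    (hC2 : ∀ x ∈ Metric.ball y ρ, ContDiffAt ℝ 2 w x)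
    (hpos : ∀ x ∈ Metric.ball y ρ, 0 < w x)
    (hlap : ∀ x ∈ Metric.ball y ρ, (Δ w) x ≤ K * w x) :
    ∃ α > 0, ∃ ε > 0, ∀ x ∈ Metric.closedBall y ρ, ρ / 2 ≤ ‖x - y‖ →
      ε * (Real.exp (-α * ‖x - y‖ ^ 2) - Real.exp (-α * ρ ^ 2)) ≤ w x := by
  -- `α` is so large that the barrier is a strict subsolution in the annulus.
  obtain ⟨α, hα, hαK⟩ : ∃ α > 0, K < α ^ 2 * ρ ^ 2 - 2 * α * N := by
    have : Tendsto (fun α : ℝ => α * (α * ρ ^ 2 - 2 * N)) atTop atTop := by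
      refine tendsto_id.atTop_mul_atTop₀ ?_
      exact tendsto_atTop_add_const_right _ _ (tendsto_id.atTop_mul_const (by positivity))
    obtain ⟨α, h1, h2⟩ := ((eventually_gt_atTop 0).and (this.eventually_gt_atTop K)).exists
    exact ⟨α, h1, by linarith⟩
  set η : ℝ → ℝ := fun s => Real.exp (-α * s ^ 2) - Real.exp (-α * ρ ^ 2) with hη
  set A : Set (EuclideanSpace ℝ (Fin N)) := {x ∈ Metric.closedBall y ρ | ρ / 2 ≤ ‖x - y‖} with hA
  have hAcomp : IsCompact A := by
    refine (isCompact_closedBall y ρ).inter_right ?_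
    exact isClosed_le (f := fun _ => ρ / 2) (g := fun x => ‖x - y‖) continuous_const (by fun_prop)
  -- a positive lower bound of `w` on the inner sphere
  obtain ⟨m, hm, hmw⟩ : ∃ m > 0, ∀ x, ‖x - y‖ = ρ / 2 → m ≤ w x := by
    have hsub : Metric.sphere y (ρ / 2) ⊆ Metric.ball y ρ := fun x hx => by
      rw [Metric.mem_sphere] at hx; rw [Metric.mem_ball, hx]; linarith
    rcases (Metric.sphere y (ρ / 2)).eq_empty_or_nonempty with h | h
    · exact ⟨1, one_pos, fun x hx => absurd (by simpa [dist_eq_norm] using hx)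
        (eq_empty_iff_forall_notMem.1 h x)⟩
    · obtain ⟨z, hz, hmin⟩ := (isCompact_sphere y (ρ / 2)).exists_isMinOn h
        (hcont.mono (hsub.trans Metric.ball_subset_closedBall))
      exact ⟨w z, hpos z (hsub hz), fun x hx => hmin (by simpa [dist_eq_norm] using hx)⟩
  refine ⟨α, hα, m, hm, fun x hx hxρ => ?_⟩
  have hη1 : ∀ s, η s ≤ 1 := fun s => by
    have h1 : Real.exp (-α * s ^ 2) ≤ 1 := Real.exp_le_one_iff.2 (by nlinarith [sq_nonneg s])
    have := Real.exp_pos (-α * ρ ^ 2)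
    simp only [hη]; linarith
  have hAcont : ContinuousOn (fun z => w z - m * η ‖z - y‖) A := by
    refine (hcont.mono fun z hz => hz.1).sub (Continuous.continuousOn ?_)
    simp only [hη]; fun_prop
  obtain ⟨z, hzA, hzmin⟩ := hAcomp.exists_isMinOn ⟨x, hx, hxρ⟩ hAcont
  by_contra! hneg
  have hz0 : w z - m * η ‖z - y‖ < 0 := lt_of_le_of_lt (hzmin ⟨hx, hxρ⟩) (by
    simp only [hη]; linarith)
  have hz1 : ‖z - y‖ ≤ ρ := by simpa [dist_eq_norm] using hzA.1
  have hwz : 0 ≤ w z := by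
    have hcl : z ∈ closure (Metric.ball y ρ) := by rw [closure_ball y hρ.ne']; exact hzA.1
    refine closure_minimal (s := Metric.ball y ρ) (t := {x ∈ Metric.closedBall y ρ | 0 ≤ w x})
      (fun t ht => ⟨Metric.ball_subset_closedBall ht, (hpos t ht).le⟩) ?_ hcl |>.2
    exact hcont.preimage_isClosed_of_isClosed Metric.isClosed_closedBall isClosed_Ici
  have hz2 : ‖z - y‖ < ρ := by
    refine lt_of_le_of_ne hz1 fun h => ?_
    have : η ‖z - y‖ = 0 := by simp [hη, h]
    rw [this] at hz0; linarith
  have hz3 : ρ / 2 < ‖z - y‖ := by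
    refine lt_of_le_of_ne hzA.2 fun h => ?_
    have := hmw z h.symm
    nlinarith [hη1 ‖z - y‖]
  have hzb : z ∈ Metric.ball y ρ := by simpa [dist_eq_norm] using hz2
  have hloc : IsLocalMin (fun z => w z - m * η ‖z - y‖) z := by
    have h1 : ∀ᶠ t in 𝓝 z, ‖t - y‖ < ρ :=
      (show ContinuousAt (fun t => ‖t - y‖) z by fun_prop).eventually_lt continuousAt_const hz2
    have h2 : ∀ᶠ t in 𝓝 z, ρ / 2 < ‖t - y‖ :=
      continuousAt_const.eventually_lt (show ContinuousAt (fun t => ‖t - y‖) z by fun_prop) hz3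
    filter_upwards [h1, h2] with t h1 h2
    exact hzmin ⟨by simpa [dist_eq_norm] using h1.le, h2.le⟩
  set r := ‖z - y‖ with hr
  have hr0 : 0 < r := by linarith
  have hd1 : ∀ s, HasDerivAt (fun s => m * η s) (m * (-2 * α * s * Real.exp (-α * s ^ 2))) s := by
    intro s
    have := ((((hasDerivAt_pow 2 s).const_mul (-α)).exp).sub_const
      (Real.exp (-α * ρ ^ 2))).const_mul m
    refine this.congr_deriv ?_
    push_cast; ring
  have hd2 : HasDerivAt (fun s => m * (-2 * α * s * Real.exp (-α * s ^ 2)))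
      (m * ((4 * α ^ 2 * r ^ 2 - 2 * α) * Real.exp (-α * r ^ 2))) r := by
    have := ((((hasDerivAt_id r).const_mul (-2 * α))).mul
      (((hasDerivAt_pow 2 r).const_mul (-α)).exp)).const_mul m
    refine this.congr_deriv ?_
    simp only [id]; push_cast; ring
  have key := radial_le_laplacian_of_isLocalMin hN (hC2 z hzb)
    (by rintro rfl; simp [hr] at hr0) (.of_forall hd1) hd2 hloc
  have hlz := hlap z hzb
  have hexp := Real.exp_pos (-α * r ^ 2)
  have e1 : m * ((4 * α ^ 2 * r ^ 2 - 2 * α) * Real.exp (-α * r ^ 2)) +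
      (N - 1) * (m * (-2 * α * r * Real.exp (-α * r ^ 2)) / r) =
      m * ((4 * α ^ 2 * r ^ 2 - 2 * α * N) * Real.exp (-α * r ^ 2)) := by
    field_simp; ring
  rw [e1] at key
  have hr2 : ρ ^ 2 ≤ 4 * r ^ 2 := by nlinarith
  have e2 : K < 4 * α ^ 2 * r ^ 2 - 2 * α * N := by nlinarith [sq_nonneg α, mul_pos hα hα]
  have e3 : K * Real.exp (-α * r ^ 2) <
      (4 * α ^ 2 * r ^ 2 - 2 * α * N) * Real.exp (-α * r ^ 2) := by gcongr
  have e4 : η r ≤ Real.exp (-α * r ^ 2) := by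
    have := Real.exp_pos (-α * ρ ^ 2)
    simp only [hη]; linarith
  have e5 : K * w z ≤ K * (m * Real.exp (-α * r ^ 2)) := by
    refine mul_le_mul_of_nonneg_left ?_ hK
    nlinarith
  nlinarith [mul_lt_mul_of_pos_left e3 hm]

/-- **Hopf's lemma**: a positive solution of `Δw ≤ K w` in a ball that vanishes at a boundary point
has a positive derivative there in the direction of the centre. -/
theorem hopf_lemma (hN : 0 < N) (hρ : 0 < ρ) (hK : 0 ≤ K)
    (hcont : ContinuousOn w (Metric.closedBall y ρ))
    (hC2 : ∀ x ∈ Metric.ball y ρ, ContDiffAt ℝ 2 w x)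
    (hpos : ∀ x ∈ Metric.ball y ρ, 0 < w x)
    (hlap : ∀ x ∈ Metric.ball y ρ, (Δ w) x ≤ K * w x)
    (hx₀ : ‖x₀ - y‖ = ρ) (hw0 : w x₀ = 0)
    {w' : EuclideanSpace ℝ (Fin N) →L[ℝ] ℝ} (hw' : HasFDerivAt w w' x₀) :
    0 < w' (y - x₀) := by
  obtain ⟨α, hα, ε, hε, hbar⟩ := exists_barrier_le_of_laplacian_le hN hρ hK hcont hC2 hpos hlap
  set q : ℝ → ℝ := fun s =>
    w (x₀ + s • (y - x₀)) - ε * (Real.exp (-α * ((1 - s) * ρ) ^ 2) - Real.exp (-α * ρ ^ 2)) with hq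
  have hl : HasDerivAt (fun s : ℝ => x₀ + s • (y - x₀)) (y - x₀) 0 := by
    simpa using ((hasDerivAt_id (0 : ℝ)).smul_const (y - x₀)).const_add x₀
  have h1 : HasDerivAt (fun s : ℝ => w (x₀ + s • (y - x₀))) (w' (y - x₀)) 0 := by
    refine HasFDerivAt.comp_hasDerivAt (0 : ℝ) ?_ hl
    simpa using hw'
  have h2 : HasDerivAt
      (fun s : ℝ => ε * (Real.exp (-α * ((1 - s) * ρ) ^ 2) - Real.exp (-α * ρ ^ 2)))
      (ε * (2 * α * ρ ^ 2 * Real.exp (-α * ρ ^ 2))) 0 := by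
    have := ((((((hasDerivAt_id (0 : ℝ)).const_sub 1).mul_const ρ).pow 2).const_mul
      (-α)).exp.sub_const (Real.exp (-α * ρ ^ 2))).const_mul ε
    refine this.congr_deriv ?_
    simp only [id, Pi.pow_apply, sub_zero, one_mul]
    push_cast
    ring
  have hqd := h1.sub h2
  -- `q ≥ q 0 = 0` to the right of `0`, so its derivative there is nonnegative.
  have hq0 : 0 ≤ w' (y - x₀) - ε * (2 * α * ρ ^ 2 * Real.exp (-α * ρ ^ 2)) := by
    refine ge_of_tendsto (hqd.tendsto_slope.mono_left
      (nhdsWithin_mono (0 : ℝ) (fun s (hs : s ∈ Ioi (0 : ℝ)) => ne_of_gt hs))) ?_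
    have h01 : ∀ᶠ s : ℝ in 𝓝[>] 0, s ∈ Ioo (0 : ℝ) (1 / 2) := Ioo_mem_nhdsGT (by norm_num)
    filter_upwards [h01] with s hs
    have hn : ‖x₀ + s • (y - x₀) - y‖ = (1 - s) * ρ := by
      have : x₀ + s • (y - x₀) - y = (1 - s) • (x₀ - y) := by module
      rw [this, norm_smul, hx₀, Real.norm_of_nonneg (by linarith [hs.2])]
    have := hbar (x₀ + s • (y - x₀))
      (by rw [mem_closedBall_iff_norm, hn]; nlinarith [hs.1]) (by rw [hn]; nlinarith [hs.2])
    rw [hn] at this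
    rw [slope_def_field]
    refine div_nonneg ?_ (by linarith [hs.1])
    simp [hw0]
    simp at this
    linarith
  have : 0 < ε * (2 * α * ρ ^ 2 * Real.exp (-α * ρ ^ 2)) := by positivity
  linarith

/-- The **strong maximum principle**, for a nonnegative function whose Laplacian is bounded by a
multiple of it near each of its zeros. -/
theorem pos_of_laplacian_le (hN : 0 < N) {U : Set (EuclideanSpace ℝ (Fin N))} (hU : IsOpen U)
    (hUc : IsPreconnected U) (hC2 : ∀ x ∈ U, ContDiffAt ℝ 2 w x) (hnn : ∀ x ∈ U, 0 ≤ w x)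
    (hlap : ∀ x ∈ U, w x = 0 → ∃ K ≥ 0, ∀ᶠ z in 𝓝 x, (Δ w) z ≤ K * w z)
    (hne : ∃ x ∈ U, w x ≠ 0) : ∀ x ∈ U, 0 < w x := by
  have hwc : ContinuousOn w U := fun x hx => (hC2 x hx).continuousAt.continuousWithinAt
  -- the zero set is open
  have hopen : ∀ x ∈ U, w x = 0 → ∀ᶠ z in 𝓝 x, w z = 0 := by
    intro x hx hwx
    obtain ⟨K, hK, hev⟩ := hlap x hx hwx
    obtain ⟨δ, hδ, hball⟩ := Metric.eventually_nhds_iff_ball.1 (hev.and (hU.mem_nhds hx))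
    refine Metric.eventually_nhds_iff_ball.2 ⟨δ / 2, by positivity, fun p hp => ?_⟩
    by_contra hwp
    -- Hopf's lemma on the largest ball about `p` in which `w` is positive contradicts `∇w = 0` at a
    -- zero `z` on its boundary
    have hpd : dist p x < δ / 2 := hp
    have hcc : Metric.closedBall p (dist p x) ⊆ Metric.ball x δ := fun t ht => by
      rw [Metric.mem_closedBall] at ht
      rw [Metric.mem_ball]
      linarith [dist_triangle t p x]
    set Z : Set (EuclideanSpace ℝ (Fin N)) := {t ∈ Metric.closedBall p (dist p x) | w t = 0} with hZ
    have hZc : IsCompact Z := by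
      refine (isCompact_closedBall p (dist p x)).of_isClosed_subset ?_ fun t ht => ht.1
      exact (hwc.mono fun t ht => (hball t (hcc ht)).2).preimage_isClosed_of_isClosed
        Metric.isClosed_closedBall isClosed_singleton
    obtain ⟨z, hz, hzmin⟩ := hZc.exists_isMinOn ⟨x, by simp [dist_comm], hwx⟩
      (f := fun t => dist t p) (by fun_prop)
    have hzU := hball z (hcc hz.1)
    have hzp : 0 < dist z p := dist_pos.2 (by rintro rfl; exact hwp hz.2)
    have hsub : Metric.closedBall p (dist z p) ⊆ Metric.ball x δ :=
      (Metric.closedBall_subset_closedBall hz.1).trans hcc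
    have hder : fderiv ℝ w z = 0 := by
      have : IsLocalMin w z := by
        filter_upwards [hU.mem_nhds hzU.2] with t ht
        rw [hz.2]; exact hnn t ht
      exact this.fderiv_eq_zero
    have := hopf_lemma (w := w) (y := p) (x₀ := z) (ρ := dist z p) (K := K) hN hzp hK
      (hwc.mono fun t ht => (hball t (hsub ht)).2)
      (fun t ht => hC2 t (hball t (hsub (Metric.ball_subset_closedBall ht))).2)
      (fun t ht => by
        have htU := (hball t (hsub (Metric.ball_subset_closedBall ht))).2
        refine lt_of_le_of_ne (hnn t htU) fun h => ?_
        have h1 : t ∈ Z := ⟨(Metric.mem_ball.1 ht).le.trans hz.1, h.symm⟩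
        exact absurd (hzmin h1) (not_le.2 (Metric.mem_ball.1 ht)))
      (fun t ht => (hball t (hsub (Metric.ball_subset_closedBall ht))).1)
      (by rw [dist_eq_norm]) hz.2 ((hC2 z hzU.2).differentiableAt (by simp)).hasFDerivAt
    rw [hder] at this
    simp at this
  intro x hx
  by_contra! hneg
  have hwx : w x = 0 := le_antisymm hneg (hnn x hx)
  obtain ⟨x', hx', hwx'⟩ := hne
  have h1 : IsOpen {z ∈ U | w z = 0} := isOpen_iff_mem_nhds.2 fun z hz => by
    filter_upwards [hopen z hz.1 hz.2, hU.mem_nhds hz.1] with t h1 h2 using ⟨h2, h1⟩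
  have h2 : IsOpen (U ∩ w ⁻¹' {0}ᶜ) := hwc.isOpen_inter_preimage hU isOpen_compl_singleton
  obtain ⟨t, -, ht1, ht2⟩ := hUc _ _ h1 h2
    (fun z hz => by
      by_cases h : w z = 0
      · exact Or.inl ⟨hz, h⟩
      · exact Or.inr ⟨hz, h⟩)
    ⟨x, hx, hx, hwx⟩ ⟨x', hx', hx', hwx'⟩
  exact ht2.2 ht1.2

end Hopf

/-! ### Reflection in a hyperplane -/

section Reflection

variable {N : ℕ}

/-- The reflection of `x` in the hyperplane `{z | ⟪e, z⟫ = l}`, for a unit vector `e`. -/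
noncomputable def planeReflection (e : EuclideanSpace ℝ (Fin N)) (l : ℝ)
    (x : EuclideanSpace ℝ (Fin N)) : EuclideanSpace ℝ (Fin N) :=
  x + (2 * (l - inner ℝ e x)) • e

variable {e x : EuclideanSpace ℝ (Fin N)} {l : ℝ}

theorem planeReflection_eq (he : ‖e‖ = 1) (l : ℝ) (x : EuclideanSpace ℝ (Fin N)) :
    planeReflection e l x = (Submodule.reflection (ℝ ∙ e)ᗮ) x + (2 * l) • e := by
  rw [Submodule.reflection_orthogonal_apply, Submodule.reflection_singleton_apply, he,
    planeReflection]
  simp only [RCLike.ofReal_real_eq_id, id, one_pow, div_one]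
  module

theorem norm_sq_planeReflection (he : ‖e‖ = 1) (l : ℝ) (x : EuclideanSpace ℝ (Fin N)) :
    ‖planeReflection e l x‖ ^ 2 = ‖x‖ ^ 2 + 4 * l * (l - inner ℝ e x) := by
  rw [planeReflection, norm_add_sq_real, inner_smul_right, norm_smul, he, real_inner_comm,
    Real.norm_eq_abs, mul_one, sq_abs]
  ring

theorem norm_planeReflection_le (he : ‖e‖ = 1) (hl : 0 ≤ l) (hx : l ≤ inner ℝ e x) :
    ‖planeReflection e l x‖ ≤ ‖x‖ := by
  refine (sq_le_sq₀ (norm_nonneg _) (norm_nonneg _)).1 ?_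
  rw [norm_sq_planeReflection he]
  nlinarith

theorem planeReflection_of_inner_eq (hx : inner ℝ e x = l) : planeReflection e l x = x := by
  simp [planeReflection, hx]

theorem continuous_planeReflection_uncurry (e : EuclideanSpace ℝ (Fin N)) :
    Continuous fun p : ℝ × EuclideanSpace ℝ (Fin N) => planeReflection e p.1 p.2 := by
  unfold planeReflection; fun_prop

theorem contDiff_planeReflection (e : EuclideanSpace ℝ (Fin N)) (l : ℝ) :
    ContDiff ℝ 2 (planeReflection e l) := by
  unfold planeReflection
  have : ContDiff ℝ 2 fun x : EuclideanSpace ℝ (Fin N) => inner ℝ e x :=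
    contDiff_const.inner ℝ contDiff_id
  fun_prop

theorem inner_le_norm_of_unit (he : ‖e‖ = 1) (x : EuclideanSpace ℝ (Fin N)) :
    inner ℝ e x ≤ ‖x‖ := by
  simpa [he] using real_inner_le_norm e x

variable {u : EuclideanSpace ℝ (Fin N) → ℝ}

theorem contDiffAt_sub_planeReflection (h1 : ContDiffAt ℝ 2 u x)
    (h2 : ContDiffAt ℝ 2 u (planeReflection e l x)) :
    ContDiffAt ℝ 2 (fun z => u z - u (planeReflection e l z)) x := by
  exact h1.sub (h2.comp x (contDiff_planeReflection e l).contDiffAt)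

theorem laplacian_sub_planeReflection (he : ‖e‖ = 1) (h1 : ContDiffAt ℝ 2 u x)
    (h2 : ContDiffAt ℝ 2 u (planeReflection e l x)) :
    (Δ fun z => u z - u (planeReflection e l z)) x = (Δ u) x - (Δ u) (planeReflection e l x) := by
  have h3 : ContDiffAt ℝ 2 (fun z => u (planeReflection e l z)) x :=
    h2.comp x (contDiff_planeReflection e l).contDiffAt
  have := h1.laplacian_sub h3
  rw [planeReflection_eq he] at h2
  have h4 := laplacian_comp_affineIsometry _ _ h2
  simp only [← planeReflection_eq he] at h4
  rw [← h4, ← this]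
  rfl

end Reflection

/-! ### The method of moving planes -/

section MovingPlanes

variable {N : ℕ} {g : ℝ → ℝ} {R b : ℝ} {u : EuclideanSpace ℝ (Fin N) → ℝ}

/-- Boundary behaviour that starts the moving planes: near the boundary `u` is increasing in `|x|`,
jointly in all directions, up to an arbitrarily small error. -/
def AlmostRadiallyMonotone (R : ℝ) (u : EuclideanSpace ℝ (Fin N) → ℝ) : Prop :=
  ∀ ε > 0, ∃ δ > 0, ∀ x ∈ Metric.ball (0 : EuclideanSpace ℝ (Fin N)) R,
    ∀ y ∈ Metric.ball (0 : EuclideanSpace ℝ (Fin N)) R, R - δ < ‖x‖ → ‖y‖ ≤ ‖x‖ → u y ≤ u x + ε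

theorem IsLargeSolution.contDiffAt (hu : IsLargeSolution g R u) {x : EuclideanSpace ℝ (Fin N)}
    (hx : ‖x‖ < R) : ContDiffAt ℝ 2 u x :=
  hu.contDiffOn.contDiffAt (Metric.isOpen_ball.mem_nhds (by simpa using hx))

theorem IsLargeSolution.laplacian_eq (hu : IsLargeSolution g R u) {x : EuclideanSpace ℝ (Fin N)}
    (hx : ‖x‖ < R) : (Δ u) x = g (u x) := by
  have := hu.equation x (by simpa using hx)
  linarith

/-- The second-order condition at a minimum of `w + m (2 - exp (-k (⟪e, ·⟫ - l)))`. -/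
theorem exp_le_laplacian_of_isLocalMin {e x : EuclideanSpace ℝ (Fin N)} (he : ‖e‖ = 1)
    {w : EuclideanSpace ℝ (Fin N) → ℝ} (hw : ContDiffAt ℝ 2 w x) {m k l : ℝ}
    (hmin : IsLocalMin (fun z => w z + m * (2 - Real.exp (-k * (inner ℝ e z - l)))) x) :
    m * k ^ 2 * Real.exp (-k * (inner ℝ e x - l)) ≤ (Δ w) x := by
  set v := EuclideanSpace.basisFun (Fin N) ℝ
  set c := Real.exp (-k * (inner ℝ e x - l)) with hc
  have key := sum_le_laplacian_of_isLocalMin (f := w) (x := x)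
    (ψ := fun z => -(m * (2 - Real.exp (-k * (inner ℝ e z - l))))) hw v
    (d := fun i => m * k ^ 2 * c * (inner ℝ e (v i)) ^ 2) ?_ (by simpa using hmin)
  · rw [← Finset.mul_sum] at key
    have h1 : ∑ i, (inner ℝ e (v i) : ℝ) ^ 2 = 1 := by
      have := v.sum_sq_norm_inner_left e
      simpa [he] using this
    rw [h1, mul_one] at key
    exact key
  · intro i
    set t : ℝ := inner ℝ e (v i)
    have hfun : (fun s : ℝ => -(m * (2 - Real.exp (-k * (inner ℝ e (x + s • v i) - l))))) =
        fun s => -(m * (2 - Real.exp (-k * (inner ℝ e x + s * t - l)))) := by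
      funext s
      rw [inner_add_right, inner_smul_right]
    rw [hfun]
    have hE : ∀ s, HasDerivAt (fun s => Real.exp (-k * (inner ℝ e x + s * t - l)))
        (-k * t * Real.exp (-k * (inner ℝ e x + s * t - l))) s := fun s => by
      have := (((((hasDerivAt_id s).mul_const t).const_add (inner ℝ e x)).sub_const l).const_mul
        (-k)).exp
      refine this.congr_deriv ?_
      simp only [id]; ring
    refine ⟨fun s => -(m * (k * t * Real.exp (-k * (inner ℝ e x + s * t - l)))),
      .of_forall fun s => ?_, ?_⟩
    · refine (((hE s).const_sub 2).const_mul m).neg.congr_deriv ?_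
      ring
    · refine (((hE 0).const_mul (k * t)).const_mul m).neg.congr_deriv ?_
      simp only [hc, zero_mul, add_zero]; ring

/-- A maximum principle for `u - u ∘ reflection` on the cap `{⟪e, x⟫ > l}`: it is enough to know its
sign outside the narrow strip `l < ⟪e, x⟫ < l + 1 / k` and outside the annulus near the boundary in
which `g` is increasing on the range of `u`. -/
theorem exists_strip_width (hg : LocallyLipschitz g) (hmono : StrictMonoOn g (Ici b))
    (hu : IsLargeSolution g R u) (hrad : AlmostRadiallyMonotone R u) {δ₀ : ℝ} (hδ₀ : 0 < δ₀)
    (hb : ∀ x : EuclideanSpace ℝ (Fin N), ‖x‖ < R → R - δ₀ < ‖x‖ → b ≤ u x) :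
    ∃ k > 0, ∀ e : EuclideanSpace ℝ (Fin N), ‖e‖ = 1 → ∀ l, 0 ≤ l →
      (∀ x, ‖x‖ ≤ R - δ₀ → l + 1 / k ≤ inner ℝ e x → u (planeReflection e l x) ≤ u x) →
      ∀ x, ‖x‖ < R → l < inner ℝ e x → u (planeReflection e l x) ≤ u x := by
  have hucont : ContinuousOn u (Metric.ball 0 R) := hu.contDiffOn.continuousOn
  -- `g` is Lipschitz on the range of `u` over the smaller ball
  obtain ⟨L, hL⟩ : ∃ L : NNReal, ∀ x y : EuclideanSpace ℝ (Fin N), ‖x‖ ≤ R - δ₀ → ‖y‖ ≤ R - δ₀ →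
      |g (u x) - g (u y)| ≤ L * |u x - u y| := by
    have hsub : Metric.closedBall (0 : EuclideanSpace ℝ (Fin N)) (R - δ₀) ⊆ Metric.ball 0 R :=
      Metric.closedBall_subset_ball (by linarith)
    have hK := (isCompact_closedBall (0 : EuclideanSpace ℝ (Fin N)) (R - δ₀)).image_of_continuousOn
      (hucont.mono hsub)
    obtain ⟨L, hL⟩ := (hg.locallyLipschitzOn
      (s := u '' Metric.closedBall 0 (R - δ₀))).exists_lipschitzOnWith_of_compact hK
    refine ⟨L, fun x y hx hy => ?_⟩
    have := hL.dist_le_mul (u x) ⟨x, by simpa using hx, rfl⟩ (u y) ⟨y, by simpa using hy, rfl⟩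
    simpa [Real.dist_eq] using this
  have hL0 : (0 : ℝ) ≤ L := L.coe_nonneg
  -- `k` satisfies `2 L < k² / 3`, where `z < 2` and `-Δz > k² / 3` in the strip
  set k : ℝ := 6 * (L + 1) with hk
  have hk0 : 0 < k := by positivity
  refine ⟨k, hk0, fun e he l hl hstrip x₁ hx₁R hx₁l => ?_⟩
  by_contra! hneg
  set w : EuclideanSpace ℝ (Fin N) → ℝ := fun z => u z - u (planeReflection e l z) with hw
  set z : EuclideanSpace ℝ (Fin N) → ℝ := fun x => 2 - Real.exp (-k * (inner ℝ e x - l)) with hz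
  have hrefl : ∀ x, ‖x‖ < R → l ≤ inner ℝ e x → ‖planeReflection e l x‖ < R := fun x h1 h2 =>
    (norm_planeReflection_le he hl h2).trans_lt h1
  have hz1 : ∀ x, l ≤ inner ℝ e x → 1 ≤ z x := fun x hx => by
    have : Real.exp (-k * (inner ℝ e x - l)) ≤ 1 := Real.exp_le_one_iff.2 (by nlinarith)
    simp only [hz]; linarith
  have hz2 : ∀ x, z x < 2 := fun x => by
    have := Real.exp_pos (-k * (inner ℝ e x - l))
    simp only [hz]; linarith
  have hzpos₁ := hz1 x₁ hx₁l.le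
  have hwx₁ : w x₁ < 0 := by simp only [hw]; linarith
  set m₀ := -(w x₁ / z x₁) with hm₀
  have hm₀pos : 0 < m₀ := by
    have := div_neg_of_neg_of_pos hwx₁ (by linarith : 0 < z x₁)
    linarith
  -- a negative minimum `-m` of `w / z` is a zero minimum of `w + m z`; near the boundary `w / z` is
  -- too large for it
  obtain ⟨δ, hδ, hδw⟩ := hrad (m₀ / 2) (by positivity)
  have hbdry : ∀ x, ‖x‖ < R → l ≤ inner ℝ e x → R - δ < ‖x‖ → -(m₀ / 2) ≤ w x := fun x h1 h2 h3 => by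
    have := hδw x (by simpa using h1) (planeReflection e l x) (by simpa using hrefl x h1 h2) h3
      (norm_planeReflection_le he hl h2)
    simp only [hw]; linarith
  set C : Set (EuclideanSpace ℝ (Fin N)) :=
    {x | x ∈ Metric.closedBall 0 (R - δ) ∧ l ≤ inner ℝ e x} with hC
  have hCR : ∀ x ∈ C, ‖x‖ < R := fun x hx => by
    have : ‖x‖ ≤ R - δ := by simpa using hx.1
    linarith
  have hCcomp : IsCompact C := (isCompact_closedBall 0 (R - δ)).inter_right
    (isClosed_le (f := fun _ => l) (g := fun x => inner ℝ e x) continuous_const (by fun_prop))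
  have hwC : ∀ x, ‖x‖ < R → l ≤ inner ℝ e x → ContDiffAt ℝ 2 w x := fun x h1 h2 =>
    contDiffAt_sub_planeReflection (hu.contDiffAt h1) (hu.contDiffAt (hrefl x h1 h2))
  have hwz : ∀ x ∈ C, ContinuousWithinAt (fun x => w x / z x) C x := fun x hx => by
    refine (hwC x (hCR x hx) hx.2).continuousAt.continuousWithinAt.div
      (Continuous.continuousWithinAt (by simp only [hz]; fun_prop)) ?_
    linarith [hz1 x hx.2]
  have hx₁C : x₁ ∈ C := by
    refine ⟨?_, hx₁l.le⟩
    by_contra h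
    have h1 := hbdry x₁ hx₁R hx₁l.le (by simpa using h)
    have h2 : w x₁ = -m₀ * z x₁ := by rw [hm₀]; field_simp
    nlinarith
  obtain ⟨x₀, hx₀C, hx₀min⟩ := hCcomp.exists_isMinOn ⟨x₁, hx₁C⟩ hwz
  set m := -(w x₀ / z x₀) with hm
  have hmm₀ : m₀ ≤ m := by have : w x₀ / z x₀ ≤ w x₁ / z x₁ := hx₀min hx₁C; linarith
  have hmpos : 0 < m := hm₀pos.trans_le hmm₀
  have hzx₀ := hz1 x₀ hx₀C.2
  have hwx₀ : w x₀ = -m * z x₀ := by rw [hm]; field_simp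
  have hx₀R := hCR x₀ hx₀C
  have hx₀l : l < inner ℝ e x₀ := by
    refine lt_of_le_of_ne hx₀C.2 fun h => ?_
    have : w x₀ = 0 := by simp only [hw]; rw [planeReflection_of_inner_eq h.symm, sub_self]
    nlinarith
  have hglob : ∀ x, ‖x‖ < R → l ≤ inner ℝ e x → 0 ≤ w x + m * z x := fun x h1 h2 => by
    have hzx := hz1 x h2
    by_cases hxC : x ∈ C
    · have : w x₀ / z x₀ ≤ w x / z x := hx₀min hxC
      have h3 : -m ≤ w x / z x := by linarith
      rw [le_div_iff₀ (by linarith)] at h3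
      linarith
    · have h3 := hbdry x h1 h2 (by
        by_contra h
        exact hxC ⟨by simpa using h, h2⟩)
      nlinarith
  have hloc : IsLocalMin (fun x => w x + m * z x) x₀ := by
    have h1 : ∀ᶠ x in 𝓝 x₀, ‖x‖ < R :=
      (show ContinuousAt (fun x => ‖x‖) x₀ by fun_prop).eventually_lt continuousAt_const hx₀R
    have h2 : ∀ᶠ x in 𝓝 x₀, l < inner ℝ e x :=
      continuousAt_const.eventually_lt (show ContinuousAt (fun x => inner ℝ e x) x₀ by fun_prop) hx₀l
    filter_upwards [h1, h2] with x h1 h2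
    have : w x₀ + m * z x₀ = 0 := by rw [hwx₀]; ring
    rw [this]
    exact hglob x h1 h2.le
  have key := exp_le_laplacian_of_isLocalMin he (hwC x₀ hx₀R hx₀C.2) hloc
  rw [laplacian_sub_planeReflection he (hu.contDiffAt hx₀R)
    (hu.contDiffAt (hrefl x₀ hx₀R hx₀C.2)), hu.laplacian_eq hx₀R,
    hu.laplacian_eq (hrefl x₀ hx₀R hx₀C.2)] at key
  have hlt : u x₀ < u (planeReflection e l x₀) := by
    have : w x₀ < 0 := by nlinarith
    simp only [hw] at this; linarith
  have hexp := Real.exp_pos (-k * (inner ℝ e x₀ - l))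
  have hpos : 0 < m * k ^ 2 * Real.exp (-k * (inner ℝ e x₀ - l)) := by positivity
  rcases lt_or_ge (R - δ₀) ‖x₀‖ with hfar | hnear
  · have hbx := hb x₀ hx₀R hfar
    have := hmono (mem_Ici.2 hbx) (mem_Ici.2 (hbx.trans hlt.le)) hlt
    linarith
  · have hin : inner ℝ e x₀ < l + 1 / k := by
      by_contra! h
      exact absurd (hstrip x₀ hnear h) (not_le.2 hlt)
    have h1 := (abs_le.1 (hL x₀ (planeReflection e l x₀) hnear
      ((norm_planeReflection_le he hl hx₀C.2).trans hnear))).2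
    have h2 : |u x₀ - u (planeReflection e l x₀)| = m * z x₀ := by
      rw [abs_of_neg (by linarith)]
      simp only [hw] at hwx₀; linarith
    rw [h2] at h1
    have h3 : Real.exp (-1) ≤ Real.exp (-k * (inner ℝ e x₀ - l)) := by
      refine Real.exp_le_exp.2 ?_
      have : k * (inner ℝ e x₀ - l) ≤ k * (1 / k) :=
        mul_le_mul_of_nonneg_left (by linarith) hk0.le
      rw [mul_one_div_cancel hk0.ne'] at this
      linarith
    have h4 : (1 : ℝ) / 3 < Real.exp (-1) := by
      rw [Real.exp_neg, one_div]
      exact inv_strictAnti₀ (Real.exp_pos 1) (by linarith [Real.exp_one_lt_d9])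
    have h5 : m * k ^ 2 * (1 / 3) ≤ m * k ^ 2 * Real.exp (-k * (inner ℝ e x₀ - l)) := by
      have : 0 ≤ m * k ^ 2 := by positivity
      gcongr
      linarith
    have h6 : L * (m * z x₀) ≤ L * (m * 2) := by
      gcongr
      exact (hz2 x₀).le
    have h7 : m * k ^ 2 * (1 / 3) ≤ L * (m * 2) := h5.trans (key.trans (h1.trans h6))
    have h8 : m * (k ^ 2 * (1 / 3) - L * 2) ≤ 0 := by linarith
    have h9 : 0 < k ^ 2 * (1 / 3) - L * 2 := by rw [hk]; nlinarith
    nlinarith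

/-- Near a zero of `u - u ∘ reflection` at which it is nonnegative, its Laplacian is bounded by a
multiple of it. -/
theorem exists_laplacian_sub_planeReflection_le (hg : LocallyLipschitz g)
    (hu : IsLargeSolution g R u) {e : EuclideanSpace ℝ (Fin N)} (he : ‖e‖ = 1) {l : ℝ}
    {x : EuclideanSpace ℝ (Fin N)} (hx : ‖x‖ < R) (hx' : ‖planeReflection e l x‖ < R)
    (hzero : u x - u (planeReflection e l x) = 0) :
    ∃ K ≥ 0, ∀ᶠ z in 𝓝 x, 0 ≤ u z - u (planeReflection e l z) →
      (Δ fun z => u z - u (planeReflection e l z)) z ≤ K * (u z - u (planeReflection e l z)) := by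
  obtain ⟨K, t, ht, hK⟩ := hg (u x)
  have hr : Tendsto (planeReflection e l) (𝓝 x) (𝓝 (planeReflection e l x)) :=
    (contDiff_planeReflection e l).continuous.continuousAt
  have e1 : ∀ᶠ z in 𝓝 x, ‖z‖ < R :=
    (show ContinuousAt (fun x => ‖x‖) x by fun_prop).eventually_lt continuousAt_const hx
  have e2 : ∀ᶠ z in 𝓝 x, ‖planeReflection e l z‖ < R :=
    hr.norm.eventually_lt tendsto_const_nhds hx'
  have e3 : ∀ᶠ z in 𝓝 x, u z ∈ t := (hu.contDiffAt hx).continuousAt.eventually ht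
  have e4 : ∀ᶠ z in 𝓝 x, u (planeReflection e l z) ∈ t := by
    refine ((hu.contDiffAt hx').continuousAt.tendsto.comp hr).eventually ?_
    rwa [← sub_eq_zero.1 hzero]
  refine ⟨K, K.coe_nonneg, ?_⟩
  filter_upwards [e1, e2, e3, e4] with z h1 h2 h3 h4 h5
  rw [laplacian_sub_planeReflection he (hu.contDiffAt h1) (hu.contDiffAt h2), hu.laplacian_eq h1,
    hu.laplacian_eq h2]
  have := hK.dist_le_mul _ h3 _ h4
  rw [Real.dist_eq, Real.dist_eq, abs_of_nonneg h5] at this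
  exact (le_abs_self _).trans this

/-- The moving-plane inequality is strict in the cap, by the strong maximum principle. -/
theorem planeReflection_lt_of_le (hN : 0 < N) (hg : LocallyLipschitz g)
    (hu : IsLargeSolution g R u) {e : EuclideanSpace ℝ (Fin N)} (he : ‖e‖ = 1) {l : ℝ}
    (hl : 0 < l) (hlR : l < R)
    (hle : ∀ x, ‖x‖ < R → l < inner ℝ e x → u (planeReflection e l x) ≤ u x) :
    ∀ x, ‖x‖ < R → l < inner ℝ e x → u (planeReflection e l x) < u x := by
  set U : Set (EuclideanSpace ℝ (Fin N)) := Metric.ball 0 R ∩ {x | l < inner ℝ e x} with hU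
  have hrefl : ∀ x ∈ U, ‖planeReflection e l x‖ < R := fun x hx =>
    (norm_planeReflection_le he hl.le (le_of_lt hx.2)).trans_lt (by simpa using hx.1)
  have hUo : IsOpen U := Metric.isOpen_ball.inter
    (isOpen_lt (f := fun _ => l) (g := fun x => inner ℝ e x) continuous_const (by fun_prop))
  have hUc : IsPreconnected U := by
    refine ((convex_ball 0 R).inter ?_).isPreconnected
    exact convex_halfSpace_gt (innerSL ℝ e).toLinearMap.isLinear l
  have key := pos_of_laplacian_le (w := fun z => u z - u (planeReflection e l z)) hN hUo hUc
    (fun x hx => contDiffAt_sub_planeReflection (hu.contDiffAt (by simpa using hx.1))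
      (hu.contDiffAt (hrefl x hx)))
    (fun x hx => sub_nonneg.2 (hle x (by simpa using hx.1) hx.2)) ?_ ?_
  · intro x hx hxl
    exact sub_pos.1 (key x ⟨by simpa using hx, hxl⟩)
  · intro x hx hwx
    obtain ⟨K, hK, hev⟩ := exists_laplacian_sub_planeReflection_le hg hu he
      (by simpa using hx.1) (hrefl x hx) hwx
    refine ⟨K, hK, ?_⟩
    filter_upwards [hev, hUo.mem_nhds hx] with z h1 h2
    exact h1 (sub_nonneg.2 (hle z (by simpa using h2.1) h2.2))
  · -- Near the boundary point `R e` the function is unbounded while its reflection is bounded.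
    have hp : ‖(2 * l - R) • e‖ < R := by
      rw [norm_smul, he, mul_one, Real.norm_eq_abs, abs_lt]
      constructor <;> linarith
    have hc : Tendsto (fun s : ℝ => u ((2 * l - s) • e)) (𝓝[<] R) (𝓝 (u ((2 * l - R) • e))) := by
      refine (hu.contDiffAt hp).continuousAt.tendsto.comp (Tendsto.mono_left ?_ nhdsWithin_le_nhds)
      exact (show ContinuousAt (fun s : ℝ => (2 * l - s) • e) R by fun_prop).tendsto
    obtain ⟨δ, hδ, hbl⟩ := hu.blowup (u ((2 * l - R) • e) + 1)
    have h1 := hc.eventually (gt_mem_nhds (lt_add_one _))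
    have h2 : ∀ᶠ s in 𝓝[<] R, s ∈ Ioo (max l (R - δ)) R :=
      Ioo_mem_nhdsLT (max_lt hlR (by linarith))
    obtain ⟨s, hs1, hs2, hs3⟩ := (h1.and h2).exists
    have hs4 : l < s := (le_max_left _ _).trans_lt hs2
    have hs5 : R - δ < s := (le_max_right _ _).trans_lt hs2
    have hinner : inner ℝ e (s • e) = s := by
      rw [inner_smul_right, real_inner_self_eq_norm_sq, he]; ring
    have hnorm : ‖s • e‖ = s := by
      rw [norm_smul, he, mul_one, Real.norm_of_nonneg (by linarith)]
    refine ⟨s • e, ⟨by simpa [hnorm] using hs3, by simpa [hinner] using hs4⟩, ?_⟩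
    have h3 := hbl (s • e) (by simpa [hnorm] using hs3) (by rwa [hnorm])
    have h4 : planeReflection e l (s • e) = (2 * l - s) • e := by
      rw [planeReflection, hinner]; module
    rw [h4]
    linarith

/-- The planes move all the way to the centre. -/
theorem planeReflection_le (hN : 0 < N) (hg : LocallyLipschitz g)
    (hmono : StrictMonoOn g (Ici b)) (hu : IsLargeSolution g R u)
    (hrad : AlmostRadiallyMonotone R u) {e : EuclideanSpace ℝ (Fin N)} (he : ‖e‖ = 1) {l : ℝ}
    (hl : 0 < l) {x : EuclideanSpace ℝ (Fin N)} (hx : ‖x‖ < R) (hxl : l < inner ℝ e x) :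
    u (planeReflection e l x) ≤ u x := by
  obtain ⟨δ₀, hδ₀, hb⟩ := hu.blowup b
  obtain ⟨k, hk, hstrip⟩ := exists_strip_width hg hmono hu hrad hδ₀
    fun x h1 h2 => (hb x (by simpa using h1) h2).le
  set P : ℝ → Prop := fun l => ∀ x, ‖x‖ < R → l < inner ℝ e x → u (planeReflection e l x) ≤ u x
    with hP
  -- far planes
  have hfar : ∀ l, 0 ≤ l → R - δ₀ ≤ l → P l := fun l hl0 hl => by
    refine hstrip e he l hl0 fun x hx1 hx2 => ?_
    have := inner_le_norm_of_unit he x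
    have : 0 < 1 / k := by positivity
    linarith
  suffices h : ∀ l, 0 < l → P l from h l hl x hx hxl
  by_contra! hbad
  obtain ⟨l₁, hl₁, hl₁P⟩ := hbad
  set S : Set ℝ := {l | 0 < l ∧ ¬ P l} with hS
  have hSb : BddAbove S := ⟨max 0 (R - δ₀), fun l hl => by
    by_contra! h
    exact hl.2 (hfar l hl.1.le ((le_max_right _ _).trans h.le))⟩
  have hSne : S.Nonempty := ⟨l₁, hl₁, hl₁P⟩
  set L := sSup S with hL
  have hL0 : 0 < L := hl₁.trans_le (le_csSup hSb ⟨hl₁, hl₁P⟩)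
  have hLgt : ∀ l, L < l → P l := fun l hl => by
    by_contra h
    exact absurd (le_csSup hSb ⟨hL0.trans hl, h⟩) (not_le.2 hl)
  have hcont : ∀ l₀ x, ‖planeReflection e l₀ x‖ < R → ContinuousAt
      (fun p : ℝ × EuclideanSpace ℝ (Fin N) => u (planeReflection e p.1 p.2)) (l₀, x) :=
    fun l₀ x h => ContinuousAt.comp
      (g := u) (f := fun p : ℝ × EuclideanSpace ℝ (Fin N) => planeReflection e p.1 p.2)
      (hu.contDiffAt h).continuousAt (continuous_planeReflection_uncurry e).continuousAt
  have hPL : P L := fun x hx hxL => by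
    have h1 := hcont L x ((norm_planeReflection_le he hL0.le hxL.le).trans_lt hx)
    have h2 : Tendsto (fun l => u (planeReflection e l x)) (𝓝[>] L)
        (𝓝 (u (planeReflection e L x))) := by
      refine (Tendsto.comp h1.tendsto (f := fun l : ℝ => (l, x)) ?_).mono_left nhdsWithin_le_nhds
      exact (show ContinuousAt (fun l : ℝ => (l, x)) L by fun_prop).tendsto
    refine le_of_tendsto h2 ?_
    filter_upwards [Ioo_mem_nhdsGT hxL] with l hl
    exact hLgt l hl.1 x hx hl.2
  have hLR : L < R := by
    by_contra! h
    refine (not_lt.2 (csSup_le hSne fun l hl => ?_)) (show max (R / 2) (R - δ₀) < L from ?_)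
    · by_contra! h'
      exact hl.2 (hfar l hl.1.le ((le_max_right _ _).trans h'.le))
    · refine max_lt ?_ (by linarith)
      have : 0 < R := (norm_nonneg x).trans_lt hx
      linarith
  have hstrict := planeReflection_lt_of_le hN hg hu he hL0 hLR hPL
  -- a compact part of the cap on which the inequality persists for nearby planes
  set K : Set (EuclideanSpace ℝ (Fin N)) :=
    {x | x ∈ Metric.closedBall 0 (R - δ₀) ∧ L + 1 / (2 * k) ≤ inner ℝ e x} with hK
  have hk2 : 0 < 1 / (2 * k) := by positivity
  have hKc : IsCompact K := (isCompact_closedBall 0 (R - δ₀)).inter_right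
    (isClosed_le (f := fun _ => L + 1 / (2 * k)) (g := fun x => inner ℝ e x) continuous_const
      (by fun_prop))
  have hev : ∀ᶠ l in 𝓝 L, ∀ x ∈ K, u (planeReflection e l x) < u x := by
    refine hKc.eventually_forall_of_forall_eventually fun x hx => ?_
    have hxR : ‖x‖ < R := by
      have : ‖x‖ ≤ R - δ₀ := by simpa using hx.1
      linarith
    have hxL : L < inner ℝ e x := by linarith [hx.2]
    have h1 := hcont L x ((norm_planeReflection_le he hL0.le hxL.le).trans_lt hxR)
    have h2 : ContinuousAt (fun p : ℝ × EuclideanSpace ℝ (Fin N) => u p.2) (L, x) :=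
      ContinuousAt.comp (g := u) (f := fun p : ℝ × EuclideanSpace ℝ (Fin N) => p.2)
        (hu.contDiffAt hxR).continuousAt continuousAt_snd
    exact h1.eventually_lt h2 (hstrict x hxR hxL)
  obtain ⟨ε, hε, hball⟩ := Metric.eventually_nhds_iff_ball.1 hev
  obtain ⟨l₂, hl₂S, hl₂⟩ := exists_lt_of_lt_csSup hSne
    (show L - min ε (1 / (2 * k)) < sSup S by
      have : 0 < min ε (1 / (2 * k)) := lt_min hε hk2
      linarith)
  have hl₂L : l₂ ≤ L := le_csSup hSb hl₂S
  refine hl₂S.2 (hstrip e he l₂ hl₂S.1.le fun x hx1 hx2 => ?_)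
  refine (hball l₂ ?_ x ⟨by simpa using hx1, ?_⟩).le
  · rw [Metric.mem_ball, Real.dist_eq, abs_lt]
    have := min_le_left ε (1 / (2 * k))
    constructor <;> linarith
  · have h1 := min_le_right ε (1 / (2 * k))
    have h2 : 1 / k = 1 / (2 * k) + 1 / (2 * k) := by field_simp; norm_num
    linarith

/-- In the limit of planes through the centre, `u` is symmetric in every such plane. -/
theorem isRadialOnBall_of_almostRadiallyMonotone (hN : 0 < N) (hg : LocallyLipschitz g)
    (hmono : StrictMonoOn g (Ici b)) (hu : IsLargeSolution g R u)
    (hrad : AlmostRadiallyMonotone R u) : IsRadialOnBall R u := by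
  have hle : ∀ (e x : EuclideanSpace ℝ (Fin N)), ‖e‖ = 1 → ‖x‖ < R → 0 < inner ℝ e x →
      u (planeReflection e 0 x) ≤ u x := fun e x he hx hex => by
    have h1 : ContinuousAt (fun l : ℝ => u (planeReflection e l x)) 0 := by
      refine ContinuousAt.comp (g := u) (f := fun l : ℝ => planeReflection e l x) ?_ ?_
      · exact (hu.contDiffAt
          ((norm_planeReflection_le he le_rfl hex.le).trans_lt hx)).continuousAt
      · unfold planeReflection; fun_prop
    refine le_of_tendsto (h1.tendsto.mono_left (nhdsWithin_le_nhds (s := Ioi 0))) ?_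
    filter_upwards [Ioo_mem_nhdsGT hex] with l hl
    exact planeReflection_le hN hg hmono hu hrad he hl.1 hx hl.2
  have hle2 : ∀ x y : EuclideanSpace ℝ (Fin N), ‖x‖ < R → ‖x‖ = ‖y‖ → u y ≤ u x := by
    intro x y hx hxy
    rcases eq_or_ne x y with rfl | hne
    · exact le_rfl
    have hd : 0 < ‖x - y‖ := norm_pos_iff.2 (sub_ne_zero.2 hne)
    have h2 : ‖x - y‖ ^ 2 = 2 * inner ℝ (x - y) x := by
      rw [norm_sub_sq_real, inner_sub_left, real_inner_self_eq_norm_sq, ← hxy, real_inner_comm]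
      ring
    have he : ‖‖x - y‖⁻¹ • (x - y)‖ = 1 := by
      rw [norm_smul, norm_inv, norm_norm, inv_mul_cancel₀ hd.ne']
    have hin : inner ℝ (‖x - y‖⁻¹ • (x - y)) x = ‖x - y‖ / 2 := by
      rw [real_inner_smul_left]
      field_simp
      linarith
    have h3 := hle _ x he hx (by rw [hin]; positivity)
    have h4 : planeReflection (‖x - y‖⁻¹ • (x - y)) 0 x = y := by
      rw [planeReflection, hin, smul_smul]
      have : 2 * (0 - ‖x - y‖ / 2) * ‖x - y‖⁻¹ = -1 := by field_simp; ring
      rw [this]; module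
    rwa [h4] at h3
  intro x hx y hy hxy
  exact le_antisymm (hle2 y x (by simpa using hy) hxy.symm) (hle2 x y (by simpa using hx) hxy)

/-- Hopf's lemma at a point of the reflection plane gives a positive normal derivative. -/
theorem radialDeriv_pos_of_almostRadiallyMonotone (hN : 0 < N) (hg : LocallyLipschitz g)
    (hmono : StrictMonoOn g (Ici b)) (hu : IsLargeSolution g R u)
    (hrad : AlmostRadiallyMonotone R u) {x : EuclideanSpace ℝ (Fin N)} (hx : ‖x‖ < R)
    (hx0 : x ≠ 0) : 0 < radialDeriv u x := by
  set l := ‖x‖ with hl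
  have hl0 : 0 < l := norm_pos_iff.2 hx0
  set e : EuclideanSpace ℝ (Fin N) := l⁻¹ • x with he_def
  have he : ‖e‖ = 1 := by rw [he_def, norm_smul, norm_inv, hl, norm_norm, inv_mul_cancel₀ hl0.ne']
  have hex : inner ℝ e x = l := by
    rw [he_def, real_inner_smul_left, real_inner_self_eq_norm_sq, ← hl]; field_simp
  set w : EuclideanSpace ℝ (Fin N) → ℝ := fun z => u z - u (planeReflection e l z) with hw
  have hpx : planeReflection e l x = x := planeReflection_of_inner_eq hex
  have hpos : ∀ z, ‖z‖ < R → l < inner ℝ e z → 0 < w z := fun z h1 h2 =>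
    sub_pos.2 (planeReflection_lt_of_le hN hg hu he hl0 hx
      (fun y h3 h4 => planeReflection_le hN hg hmono hu hrad he hl0 h3 h4) z h1 h2)
  have hwx : w x = 0 := by simp only [hw, hpx, sub_self]
  obtain ⟨K, hK, hev⟩ := exists_laplacian_sub_planeReflection_le hg hu he hx (by rwa [hpx]) hwx
  obtain ⟨δ, hδ, hball⟩ := Metric.eventually_nhds_iff_ball.1 hev
  -- a ball in the cap touching the plane at `x`
  set ρ := min (δ / 3) ((R - l) / 3) with hρ
  have hρ0 : 0 < ρ := lt_min (by positivity) (by linarith)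
  have hρ1 : ρ ≤ δ / 3 := min_le_left _ _
  have hρ2 : ρ ≤ (R - l) / 3 := min_le_right _ _
  set y := x + ρ • e with hy
  have hyx : ‖x - y‖ = ρ := by
    rw [hy, sub_add_cancel_left, norm_neg, norm_smul, he, mul_one, Real.norm_of_nonneg hρ0.le]
  have hnear : ∀ z ∈ Metric.closedBall y ρ, ‖z - x‖ ≤ 2 * ρ := fun z hz => by
    have h1 : ‖z - y‖ ≤ ρ := by simpa [dist_eq_norm] using hz
    have h2 : z - x = (z - y) - (x - y) := by abel
    rw [h2]
    exact (norm_sub_le _ _).trans (by linarith)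
  have hzR : ∀ z ∈ Metric.closedBall y ρ, ‖z‖ < R := fun z hz => by
    have h1 := hnear z hz
    have h2 : ‖z‖ ≤ ‖z - x‖ + ‖x‖ := by simpa using norm_add_le (z - x) x
    linarith
  have hey : inner ℝ e y = l + ρ := by
    rw [hy, inner_add_right, hex, inner_smul_right, real_inner_self_eq_norm_sq, he]; ring
  have hin : ∀ z, inner ℝ e z = l + ρ - inner ℝ e (y - z) := fun z => by
    rw [inner_sub_right, hey]; ring
  have hzl : ∀ z ∈ Metric.closedBall y ρ, l ≤ inner ℝ e z := fun z hz => by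
    have h1 : ‖y - z‖ ≤ ρ := by simpa [dist_eq_norm, norm_sub_rev] using hz
    rw [hin z]
    linarith [inner_le_norm_of_unit he (y - z)]
  have hzl' : ∀ z ∈ Metric.ball y ρ, l < inner ℝ e z := fun z hz => by
    have h1 : ‖y - z‖ < ρ := by simpa [dist_eq_norm, norm_sub_rev] using hz
    rw [hin z]
    linarith [inner_le_norm_of_unit he (y - z)]
  have hC2 : ∀ z, ‖z‖ < R → l ≤ inner ℝ e z → ContDiffAt ℝ 2 w z := fun z h1 h2 =>
    contDiffAt_sub_planeReflection (hu.contDiffAt h1)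
      (hu.contDiffAt ((norm_planeReflection_le he hl0.le h2).trans_lt h1))
  have hud := (hu.contDiffAt hx).differentiableAt (by simp)
  have hwd := (hC2 x hx hex.ge).differentiableAt (by simp)
  have key := hopf_lemma (w := w) (x₀ := x) hN hρ0 hK
    (fun z hz => (hC2 z (hzR z hz) (hzl z hz)).continuousAt.continuousWithinAt)
    (fun z hz => hC2 z (hzR z (Metric.ball_subset_closedBall hz)) (hzl' z hz).le)
    (fun z hz => hpos z (hzR z (Metric.ball_subset_closedBall hz)) (hzl' z hz))
    (fun z hz => by
      refine hball z ?_ (hpos z (hzR z (Metric.ball_subset_closedBall hz)) (hzl' z hz)).le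
      rw [mem_ball_iff_norm]
      linarith [hnear z (Metric.ball_subset_closedBall hz)])
    hyx hwx hwd.hasFDerivAt
  -- along the normal line, `w (x + s e) = u (x + s e) - u (x - s e)`
  have hline : ∀ t : ℝ, HasDerivAt (fun s : ℝ => x + (t * s) • e) (t • e) 0 := fun t => by
    have h : HasDerivAt (fun s : ℝ => t * s) t 0 := by
      simpa using (hasDerivAt_id (0 : ℝ)).const_mul t
    exact (h.smul_const e).const_add x
  have hul : ∀ t : ℝ, HasDerivAt (fun s : ℝ => u (x + (t * s) • e)) (fderiv ℝ u x (t • e)) 0 :=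
    fun t => by
      refine HasFDerivAt.comp_hasDerivAt (0 : ℝ) ?_ (hline t)
      simpa using hud.hasFDerivAt
  have hwl : HasDerivAt (fun s : ℝ => w (x + (1 * s) • e)) (fderiv ℝ w x ((1 : ℝ) • e)) 0 := by
    have h : HasFDerivAt w (fderiv ℝ w x) (x + ((1 : ℝ) * 0) • e) := by
      simpa using hwd.hasFDerivAt
    exact h.comp_hasDerivAt (0 : ℝ) (hline 1)
  have heq : (fun s : ℝ => w (x + (1 * s) • e)) =
      fun s : ℝ => u (x + (1 * s) • e) - u (x + (-1 * s) • e) := by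
    funext s
    have : planeReflection e l (x + (1 * s) • e) = x + (-1 * s) • e := by
      rw [planeReflection, inner_add_right, hex, inner_smul_right, real_inner_self_eq_norm_sq, he]
      module
    simp only [hw, this]
  rw [heq] at hwl
  have h1 := hwl.unique ((hul 1).sub (hul (-1)))
  have h2 : y - x = ρ • e := by rw [hy, add_sub_cancel_left]
  rw [h2, map_smul, smul_eq_mul] at key
  have h3 : 0 < fderiv ℝ w x e := pos_of_mul_pos_right key hρ0.le
  rw [one_smul, neg_one_smul, map_neg] at h1
  have h4 : radialDeriv u x = fderiv ℝ u x e := by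
    rw [radialDeriv, gradient, InnerProductSpace.toDual_symm_apply]
  rw [h4]
  linarith

end MovingPlanes

/-! ### Consequences of convexity and of the Keller-Osserman condition -/

section KellerOssermanFacts

variable {g : ℝ → ℝ} {a : ℝ}

/-- Increments of a convex function over a larger interval further to the right. -/
theorem ConvexOn.add_mul_sub_le (hconv : ConvexOn ℝ (Ici a) g) {A x y z : ℝ} (hA : 0 ≤ A)
    (hx : a ≤ x) (hxy : x ≤ y) (hyz : y ≤ z) : g z + A * (g y - g x) ≤ g (z + A * (y - x)) := by
  rcases eq_or_lt_of_le hxy with rfl | hxy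
  · simp
  set w := z + A * (y - x) with hw
  have hAh : 0 ≤ A * (y - x) := mul_nonneg hA (by linarith)
  have hL : 0 < w - x := by linarith
  have hxI : x ∈ Ici a := hx
  have hwI : w ∈ Ici a := mem_Ici.2 (by linarith)
  have h1 : g ((1 - (y - x) / (w - x)) • x + ((y - x) / (w - x)) • w) ≤
      (1 - (y - x) / (w - x)) • g x + ((y - x) / (w - x)) • g w := hconv.2 hxI hwI
    (sub_nonneg.2 ((div_le_one hL).2 (by linarith))) (div_nonneg (by linarith) hL.le) (by ring)
  have h2 : g ((A * (y - x) / (w - x)) • x + (1 - A * (y - x) / (w - x)) • w) ≤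
      (A * (y - x) / (w - x)) • g x + (1 - A * (y - x) / (w - x)) • g w := hconv.2 hxI hwI
    (div_nonneg hAh hL.le) (sub_nonneg.2 ((div_le_one hL).2 (by linarith))) (by ring)
  have e1 : (1 - (y - x) / (w - x)) • x + ((y - x) / (w - x)) • w = y := by
    simp only [smul_eq_mul]; field_simp; ring
  have e2 : (A * (y - x) / (w - x)) • x + (1 - A * (y - x) / (w - x)) • w = z := by
    simp only [smul_eq_mul]; field_simp; rw [hw]; ring
  rw [e1] at h1
  rw [e2] at h2
  simp only [smul_eq_mul] at h1 h2
  have h3 := mul_le_mul_of_nonneg_left h1 hA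
  have h4 : A * ((1 - (y - x) / (w - x)) * g x + (y - x) / (w - x) * g w) +
      (A * (y - x) / (w - x) * g x + (1 - A * (y - x) / (w - x)) * g w) = A * g x + g w := by
    ring
  linarith

theorem hasDerivAt_primitiveFrom (hg : Continuous g) (a t : ℝ) :
    HasDerivAt (primitiveFrom g a) (g t) t :=
  intervalIntegral.integral_hasDerivAt_right (hg.intervalIntegrable a t)
    hg.aestronglyMeasurable.stronglyMeasurableAtFilter hg.continuousAt

theorem continuous_primitiveFrom (hg : Continuous g) (a : ℝ) : Continuous (primitiveFrom g a) :=
  continuous_iff_continuousAt.2 fun t => (hasDerivAt_primitiveFrom hg a t).continuousAt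

theorem strictMonoOn_primitiveFrom (hg : Continuous g) (hpos : ∀ s ∈ Ici a, 0 < g s) :
    StrictMonoOn (primitiveFrom g a) (Ici a) := by
  refine strictMonoOn_of_deriv_pos (convex_Ici a) (continuous_primitiveFrom hg a).continuousOn ?_
  intro x hx
  rw [(hasDerivAt_primitiveFrom hg a x).deriv]
  exact hpos x (interior_subset hx)

theorem primitiveFrom_pos (hg : Continuous g) (hpos : ∀ s ∈ Ici a, 0 < g s) {t : ℝ} (ht : a < t) :
    0 < primitiveFrom g a t := by
  have := strictMonoOn_primitiveFrom hg hpos self_mem_Ici (mem_Ici.2 ht.le) ht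
  rwa [primitiveFrom, intervalIntegral.integral_same] at this

theorem tendsto_tail_zero (g : ℝ → ℝ) (a : ℝ) :
    Tendsto (fun t => ∫ s in Ioi t, 1 / √(primitiveFrom g a s)) atTop (𝓝 0) :=
  tendsto_integral_Ioi_zero tendsto_id

/-- `√G` grows faster than linearly. -/
theorem tendsto_div_sqrt_primitiveFrom (hg : Continuous g) (hpos : ∀ s ∈ Ici a, 0 < g s)
    (hKO : KellerOsserman g a) :
    Tendsto (fun t => t / √(primitiveFrom g a t)) atTop (𝓝 0) := by
  have h2 : Tendsto (fun t : ℝ => t / 2) atTop atTop := tendsto_id.atTop_div_const (by norm_num)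
  have h := ((tendsto_tail_zero g a).comp h2).const_mul 2
  rw [mul_zero] at h
  refine tendsto_of_tendsto_of_tendsto_of_le_of_le' tendsto_const_nhds h ?_ ?_
  · filter_upwards [eventually_ge_atTop 0] with t ht
    positivity
  · filter_upwards [h2.eventually_gt_atTop a, eventually_gt_atTop 0] with t ht ht0
    have hle : t / 2 ≤ t := by linarith
    have hsub : Ioc (t / 2) t ⊆ Ioi a := fun s hs => ht.trans hs.1
    have h3 : ∫ s in Ioc (t / 2) t, 1 / √(primitiveFrom g a t) ≤
        ∫ s in Ioc (t / 2) t, 1 / √(primitiveFrom g a s) := by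
      refine setIntegral_mono_on (by simp) (hKO.mono_set hsub) measurableSet_Ioc fun s hs => ?_
      have hGs := primitiveFrom_pos hg hpos (hsub hs)
      refine one_div_le_one_div_of_le (Real.sqrt_pos.2 hGs) (Real.sqrt_le_sqrt ?_)
      exact (strictMonoOn_primitiveFrom hg hpos).monotoneOn (mem_Ici.2 (hsub hs).le)
        (mem_Ici.2 (ht.le.trans hle)) hs.2
    have h4 : ∫ s in Ioc (t / 2) t, 1 / √(primitiveFrom g a s) ≤
        ∫ s in Ioi (t / 2), 1 / √(primitiveFrom g a s) := by
      refine setIntegral_mono_set (hKO.mono_set (Ioi_subset_Ioi ht.le)) ?_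
        (Eventually.of_forall Ioc_subset_Ioi_self)
      exact .of_forall fun s => by positivity
    rw [setIntegral_const, measureReal_def, Real.volume_Ioc,
      ENNReal.toReal_ofReal (by linarith), smul_eq_mul] at h3
    have h5 : (t - t / 2) * (1 / √(primitiveFrom g a t)) = t / √(primitiveFrom g a t) / 2 := by ring
    simp only [Function.comp]
    linarith

theorem eventually_mul_le_sqrt_primitiveFrom (hg : Continuous g) (hpos : ∀ s ∈ Ici a, 0 < g s)
    (hKO : KellerOsserman g a) (κ : ℝ) : ∀ᶠ t in atTop, κ * t ≤ √(primitiveFrom g a t) := by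
  have h := (tendsto_div_sqrt_primitiveFrom hg hpos hKO).eventually
    (gt_mem_nhds (show (0 : ℝ) < 1 / (|κ| + 1) by positivity))
  filter_upwards [h, eventually_gt_atTop a, eventually_gt_atTop 0] with t h1 h2 h3
  have hG := Real.sqrt_pos.2 (primitiveFrom_pos hg hpos h2)
  rw [div_lt_div_iff₀ hG (by positivity)] at h1
  nlinarith [le_abs_self κ]

/-- The nonlinearity is eventually strictly increasing. -/
theorem exists_strictMonoOn_Ici (hg : Continuous g) (hpos : ∀ s ∈ Ici a, 0 < g s)
    (hconv : ConvexOn ℝ (Ici a) g) (hKO : KellerOsserman g a) :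
    ∃ b > a, g a < g b ∧ StrictMonoOn g (Ici b) := by
  obtain ⟨b, hab, hlt⟩ : ∃ b > a, g a < g b := by
    by_contra! hbd
    obtain ⟨t, ⟨h1, h2⟩, h3⟩ := (((eventually_mul_le_sqrt_primitiveFrom hg hpos hKO
      (g a + 1)).and (eventually_gt_atTop (max a 1))).and (eventually_gt_atTop (-a))).exists
    have hta : a < t := (le_max_left _ _).trans_lt h2
    have ht1 : 1 < t := (le_max_right _ _).trans_lt h2
    have hga := hpos a self_mem_Ici
    have h4 : primitiveFrom g a t ≤ ∫ _ in a..t, g a := by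
      refine intervalIntegral.integral_mono_on hta.le (hg.intervalIntegrable _ _) (by simp) ?_
      intro s hs
      rcases eq_or_lt_of_le hs.1 with h | h
      · rw [h]
      · exact hbd s h
    rw [intervalIntegral.integral_const, smul_eq_mul] at h4
    have h5 := Real.sq_sqrt (primitiveFrom_pos hg hpos hta).le
    have h6 : ((g a + 1) * t) ^ 2 ≤ √(primitiveFrom g a t) ^ 2 := by gcongr
    have h7 : (t - a) * g a ≤ 2 * t * g a := by gcongr; linarith
    have h8 : t * 1 ≤ t * t := by gcongr
    nlinarith [mul_pos hga hga]
  refine ⟨b, hab, hlt, fun x hx y hy hxy => ?_⟩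
  have hba : 0 < b - a := sub_pos.2 hab
  have hA : 0 < (y - x) / (b - a) := div_pos (sub_pos.2 hxy) hba
  have h := hconv.add_mul_sub_le hA.le le_rfl hab.le hx
  rw [div_mul_cancel₀ _ hba.ne', add_sub_cancel] at h
  nlinarith

/-- `g / √G → ∞`. -/
theorem eventually_mul_sqrt_primitiveFrom_le (hg : Continuous g) (hpos : ∀ s ∈ Ici a, 0 < g s)
    (hconv : ConvexOn ℝ (Ici a) g) (hKO : KellerOsserman g a) (κ : ℝ) :
    ∀ᶠ t in atTop, κ * √(primitiveFrom g a t) ≤ g t := by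
  obtain ⟨b, hab, hlt, hmono⟩ := exists_strictMonoOn_Ici hg hpos hconv hKO
  filter_upwards [eventually_mul_le_sqrt_primitiveFrom hg hpos hKO (2 * |κ|), eventually_gt_atTop b,
    eventually_gt_atTop 0, eventually_gt_atTop (-a)] with t h1 hbt ht0 hta'
  have hat : a < t := hab.trans hbt
  have hgt := hpos t (mem_Ici.2 hat.le)
  have hbt' : g b ≤ g t := (hmono self_mem_Ici (mem_Ici.2 hbt.le) hbt).le
  -- by convexity the maximum of `g` over `[a, t]` is `g t`
  have h2 : primitiveFrom g a t ≤ ∫ _ in a..t, g t := by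
    refine intervalIntegral.integral_mono_on hat.le (hg.intervalIntegrable _ _) (by simp) ?_
    intro s hs
    refine (hconv.le_max_of_mem_Icc self_mem_Ici (mem_Ici.2 hat.le) hs).trans ?_
    exact max_le (hlt.le.trans hbt') le_rfl
  rw [intervalIntegral.integral_const, smul_eq_mul] at h2
  have hG := primitiveFrom_pos hg hpos hat
  have hs := Real.sqrt_pos.2 hG
  have h4 : 2 * |κ| * t * √(primitiveFrom g a t) ≤ (2 * t) * g t := by
    calc 2 * |κ| * t * √(primitiveFrom g a t) ≤ √(primitiveFrom g a t) * √(primitiveFrom g a t) := by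
          gcongr
      _ = primitiveFrom g a t := Real.mul_self_sqrt hG.le
      _ ≤ (t - a) * g t := h2
      _ ≤ (2 * t) * g t := by gcongr; linarith
  have h5 : |κ| * √(primitiveFrom g a t) ≤ g t := by
    refine le_of_mul_le_mul_left (a := 2 * t) ?_ (by linarith)
    linarith
  exact (mul_le_mul_of_nonneg_right (le_abs_self κ) hs.le).trans h5

theorem tendsto_atTop_of_keller_osserman (hg : Continuous g) (hpos : ∀ s ∈ Ici a, 0 < g s)
    (hconv : ConvexOn ℝ (Ici a) g) (hKO : KellerOsserman g a) : Tendsto g atTop atTop := by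
  refine tendsto_atTop_mono' _ ?_ tendsto_id
  filter_upwards [eventually_mul_sqrt_primitiveFrom_le hg hpos hconv hKO 1,
    eventually_mul_le_sqrt_primitiveFrom hg hpos hKO 1] with t h1 h2
  simp only [id]; linarith

end KellerOssermanFacts

/-! ### The radial equation in the phase plane -/

section Tail

variable {f : ℝ → ℝ} {b : ℝ}

theorem integral_Ioi_eq_sub (hf : IntegrableOn f (Ioi b)) {t : ℝ} (ht : b ≤ t) :
    ∫ s in Ioi t, f s = (∫ s in Ioi b, f s) - ∫ s in b..t, f s := by
  rw [← intervalIntegral.integral_Ioi_sub_Ioi hf ht]; ring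

theorem hasDerivAt_integral_Ioi (hc : ContinuousOn f (Ioi b)) (hf : IntegrableOn f (Ioi b))
    {t : ℝ} (ht : b < t) : HasDerivAt (fun t => ∫ s in Ioi t, f s) (-f t) t := by
  have h1 : HasDerivAt (fun t => ∫ s in b..t, f s) (f t) t := by
    refine intervalIntegral.integral_hasDerivAt_right ?_ ?_ (hc.continuousAt (Ioi_mem_nhds ht))
    · rw [intervalIntegrable_iff_integrableOn_Ioc_of_le ht.le]
      exact hf.mono_set Ioc_subset_Ioi_self
    · exact hc.stronglyMeasurableAtFilter isOpen_Ioi t ht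
  refine (h1.const_sub (∫ s in Ioi b, f s)).congr_of_eventuallyEq ?_
  filter_upwards [lt_mem_nhds ht] with s hs
  exact integral_Ioi_eq_sub hf hs.le

theorem continuous_integral_Ioi_max (hf : IntegrableOn f (Ioi b)) :
    Continuous fun t => ∫ s in Ioi (max t b), f s := by
  have h1 : ContinuousOn (fun t => ∫ s in b..t, f s) (Ici b) := by
    intro t ht
    have h2 : IntegrableOn f (uIcc b (t + 1)) := by
      rw [uIcc_of_le (by linarith [mem_Ici.1 ht]), integrableOn_Icc_iff_integrableOn_Ioc]
      exact hf.mono_set Ioc_subset_Ioi_self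
    have h3 := (intervalIntegral.continuousOn_primitive_interval h2) t
      (by rw [uIcc_of_le (by linarith [mem_Ici.1 ht])]; exact ⟨ht, by linarith⟩)
    rw [uIcc_of_le (by linarith [mem_Ici.1 ht])] at h3
    refine h3.mono_of_mem_nhdsWithin ?_
    filter_upwards [self_mem_nhdsWithin, mem_nhdsWithin_of_mem_nhds (gt_mem_nhds (lt_add_one t))]
      with s hs1 hs2 using ⟨hs1, hs2.le⟩
  have h2 : (fun t => ∫ s in Ioi (max t b), f s) =
      fun t => (∫ s in Ioi b, f s) - ∫ s in b..(max t b), f s := by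
    funext t
    exact integral_Ioi_eq_sub hf (le_max_right _ _)
  rw [h2]
  refine continuous_const.sub ?_
  exact h1.comp_continuous (by fun_prop) fun t => mem_Ici.2 (le_max_right _ _)

end Tail

/-- The weighted primitive `∫_a^t Φ(r)² g` of `g` along a radius function `r`. For `Φ(r) = r ^ (N -
1)` and a radial solution with slope `p` as a function of its value `t`, the equation `(r ^ (N - 1)
p)' p = r ^ (N - 1) g` says that this is `(r ^ (N - 1) p)² / 2` up to a constant. -/
noncomputable def weightedPrimitive (Φ g : ℝ → ℝ) (a : ℝ) (r : ℝ → ℝ) (t : ℝ) : ℝ :=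
  ∫ s in a..t, Φ (r s) ^ 2 * g s

section FixedPoint

variable {Φ g : ℝ → ℝ} {a m M K : ℝ}

theorem abs_one_div_sqrt_sub_le {x y z : ℝ} (hz : 0 < z) (hx : z ≤ x) (hy : z ≤ y) :
    |1 / √x - 1 / √y| ≤ |x - y| / (2 * z * √z) := by
  have hz' := Real.sqrt_pos.2 hz
  have hx' := Real.sqrt_le_sqrt hx
  have hy' := Real.sqrt_le_sqrt hy
  have hx0 : 0 < √x := hz'.trans_le hx'
  have hy0 : 0 < √y := hz'.trans_le hy'
  have e1 : x - y = (√x - √y) * (√x + √y) := by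
    have h1 := Real.mul_self_sqrt (hz.le.trans hx)
    have h2 := Real.mul_self_sqrt (hz.le.trans hy)
    nlinarith
  have e2 : 1 / √x - 1 / √y = -(x - y) / (√x * √y * (√x + √y)) := by
    rw [e1]; field_simp; ring
  rw [e2, abs_div, abs_neg, abs_of_pos (by positivity : 0 < √x * √y * (√x + √y))]
  refine div_le_div_of_nonneg_left (abs_nonneg _) (by positivity) ?_
  have h1 : √z * √z ≤ √x * √y := mul_le_mul hx' hy' hz'.le hx0.le
  rw [Real.mul_self_sqrt hz.le] at h1
  have h2 : 2 * √z ≤ √x + √y := by linarith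
  calc 2 * z * √z = z * (2 * √z) := by ring
    _ ≤ √x * √y * (√x + √y) := mul_le_mul h1 h2 (by positivity) (by positivity)

theorem hasDerivAt_weightedPrimitive (hg : Continuous g) (hΦ : Continuous Φ) {r : ℝ → ℝ}
    (hr : Continuous r) (t : ℝ) :
    HasDerivAt (weightedPrimitive Φ g a r) (Φ (r t) ^ 2 * g t) t := by
  have hc : Continuous fun s => Φ (r s) ^ 2 * g s := by fun_prop
  exact intervalIntegral.integral_hasDerivAt_right (hc.intervalIntegrable a t)
    hc.aestronglyMeasurable.stronglyMeasurableAtFilter hc.continuousAt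

theorem le_weightedPrimitive (hg : Continuous g) (hpos : ∀ s ∈ Ici a, 0 < g s)
    (hΦ : Continuous Φ) (hm : 0 < m) (hmΦ : ∀ x, m ≤ Φ x) {r : ℝ → ℝ} (hr : Continuous r)
    {t : ℝ} (ht : a ≤ t) : m ^ 2 * primitiveFrom g a t ≤ weightedPrimitive Φ g a r t := by
  have hc : Continuous fun s => Φ (r s) ^ 2 * g s := by fun_prop
  rw [primitiveFrom, ← intervalIntegral.integral_const_mul]
  refine intervalIntegral.integral_mono_on ht ((hg.const_mul _).intervalIntegrable _ _)
    (hc.intervalIntegrable _ _) fun s hs => ?_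
  have := hpos s hs.1
  have := hmΦ (r s)
  gcongr

theorem weightedPrimitive_le (hg : Continuous g) (hpos : ∀ s ∈ Ici a, 0 < g s)
    (hΦ : Continuous Φ) (hm : 0 < m) (hmΦ : ∀ x, m ≤ Φ x) (hΦM : ∀ x, Φ x ≤ M) {r : ℝ → ℝ}
    (hr : Continuous r) {t : ℝ} (ht : a ≤ t) :
    weightedPrimitive Φ g a r t ≤ M ^ 2 * primitiveFrom g a t := by
  have hc : Continuous fun s => Φ (r s) ^ 2 * g s := by fun_prop
  rw [primitiveFrom, ← intervalIntegral.integral_const_mul]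
  refine intervalIntegral.integral_mono_on ht (hc.intervalIntegrable _ _)
    ((hg.const_mul _).intervalIntegrable _ _) fun s hs => ?_
  have := hpos s hs.1
  have h1 := hmΦ (r s)
  have h2 : 0 ≤ Φ (r s) := hm.le.trans h1
  have := hΦM (r s)
  gcongr

theorem abs_weightedPrimitive_sub_le (hg : Continuous g) (hpos : ∀ s ∈ Ici a, 0 < g s)
    (hΦ : Continuous Φ) (hm : 0 < m) (hmΦ : ∀ x, m ≤ Φ x) (hΦM : ∀ x, Φ x ≤ M)
    (hK : ∀ x y, |Φ x - Φ y| ≤ K * |x - y|) (hK0 : 0 ≤ K) {r₁ r₂ : ℝ → ℝ}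
    (hr₁ : Continuous r₁) (hr₂ : Continuous r₂) {d : ℝ} (hd : ∀ s, |r₁ s - r₂ s| ≤ d)
    {t : ℝ} (ht : a ≤ t) :
    |weightedPrimitive Φ g a r₁ t - weightedPrimitive Φ g a r₂ t| ≤
      2 * M * K * d * primitiveFrom g a t := by
  have hc₁ : Continuous fun s => Φ (r₁ s) ^ 2 * g s := by fun_prop
  have hc₂ : Continuous fun s => Φ (r₂ s) ^ 2 * g s := by fun_prop
  rw [weightedPrimitive, weightedPrimitive, ← intervalIntegral.integral_sub
    (hc₁.intervalIntegrable _ _) (hc₂.intervalIntegrable _ _), primitiveFrom,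
    ← intervalIntegral.integral_const_mul]
  refine (intervalIntegral.abs_integral_le_integral_abs ht).trans ?_
  refine intervalIntegral.integral_mono_on ht ((hc₁.sub hc₂).abs.intervalIntegrable _ _)
    ((hg.const_mul _).intervalIntegrable _ _) fun s hs => ?_
  have hgs := hpos s hs.1
  have e : Φ (r₁ s) ^ 2 * g s - Φ (r₂ s) ^ 2 * g s =
      (Φ (r₁ s) - Φ (r₂ s)) * ((Φ (r₁ s) + Φ (r₂ s)) * g s) := by ring
  have hp : 0 < Φ (r₁ s) + Φ (r₂ s) := by linarith [hmΦ (r₁ s), hmΦ (r₂ s)]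
  rw [e, abs_mul, abs_of_pos (mul_pos hp hgs)]
  have h1 : |Φ (r₁ s) - Φ (r₂ s)| ≤ K * d :=
    (hK _ _).trans (mul_le_mul_of_nonneg_left (hd s) hK0)
  have h2 : Φ (r₁ s) + Φ (r₂ s) ≤ 2 * M := by linarith [hΦM (r₁ s), hΦM (r₂ s)]
  calc |Φ (r₁ s) - Φ (r₂ s)| * ((Φ (r₁ s) + Φ (r₂ s)) * g s)
      ≤ (K * d) * ((2 * M) * g s) := by gcongr; exact (abs_nonneg _).trans h1
    _ = 2 * M * K * d * g s := by ring

/-- Bound for the speed `dr/dt = Φ(r) / √(2 ∫_a^t Φ(r)² g)`. -/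
theorem speed_le (hg : Continuous g) (hpos : ∀ s ∈ Ici a, 0 < g s)
    (hΦ : Continuous Φ) (hm : 0 < m) (hmΦ : ∀ x, m ≤ Φ x) (hΦM : ∀ x, Φ x ≤ M) {r : ℝ → ℝ}
    (hr : Continuous r) {t : ℝ} (ht : a < t) :
    Φ (r t) / √(2 * weightedPrimitive Φ g a r t) ≤ M / m * (1 / √(primitiveFrom g a t)) := by
  have hG := primitiveFrom_pos hg hpos ht
  have hP := le_weightedPrimitive hg hpos hΦ hm hmΦ hr ht.le
  have h1 : m * √(primitiveFrom g a t) ≤ √(2 * weightedPrimitive Φ g a r t) := by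
    refine Real.le_sqrt_of_sq_le ?_
    rw [mul_pow, Real.sq_sqrt hG.le]
    nlinarith [mul_pos (pow_pos hm 2) hG]
  have hs := Real.sqrt_pos.2 hG
  rw [show M / m * (1 / √(primitiveFrom g a t)) = M / (m * √(primitiveFrom g a t)) by
    field_simp]
  exact div_le_div₀ ((hm.le.trans (hmΦ 0)).trans (hΦM 0)) (hΦM _) (by positivity) h1

/-- The speed is Lipschitz in the radius function, with a constant that is integrable in `t` by the
Keller-Osserman condition. -/
theorem abs_speed_sub_le (hg : Continuous g) (hpos : ∀ s ∈ Ici a, 0 < g s)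
    (hΦ : Continuous Φ) (hm : 0 < m) (hmΦ : ∀ x, m ≤ Φ x) (hΦM : ∀ x, Φ x ≤ M)
    (hK : ∀ x y, |Φ x - Φ y| ≤ K * |x - y|) (hK0 : 0 ≤ K) {r₁ r₂ : ℝ → ℝ}
    (hr₁ : Continuous r₁) (hr₂ : Continuous r₂) {d : ℝ} (hd : ∀ s, |r₁ s - r₂ s| ≤ d)
    {t : ℝ} (ht : a < t) :
    |Φ (r₁ t) / √(2 * weightedPrimitive Φ g a r₁ t) -
      Φ (r₂ t) / √(2 * weightedPrimitive Φ g a r₂ t)| ≤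
      (K / m + 2 * (M ^ 2 * K / m ^ 3)) * d * (1 / √(primitiveFrom g a t)) := by
  set G := primitiveFrom g a t with hGdef
  set P₁ := weightedPrimitive Φ g a r₁ t
  set P₂ := weightedPrimitive Φ g a r₂ t
  have hG : 0 < G := primitiveFrom_pos hg hpos ht
  have hP₁ : m ^ 2 * G ≤ P₁ := le_weightedPrimitive hg hpos hΦ hm hmΦ hr₁ ht.le
  have hP₂ : m ^ 2 * G ≤ P₂ := le_weightedPrimitive hg hpos hΦ hm hmΦ hr₂ ht.le
  have hdP := abs_weightedPrimitive_sub_le hg hpos hΦ hm hmΦ hΦM hK hK0 hr₁ hr₂ hd ht.le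
  change |P₁ - P₂| ≤ 2 * M * K * d * G at hdP
  have hz : 0 < m ^ 2 * G := by positivity
  have hs := Real.sqrt_pos.2 hG
  have hsz : √(m ^ 2 * G) = m * √G := by rw [Real.sqrt_mul (by positivity), Real.sqrt_sq hm.le]
  have hd0 : 0 ≤ d := (abs_nonneg _).trans (hd 0)
  have hM : 0 ≤ M := (hm.le.trans (hmΦ 0)).trans (hΦM 0)
  have e : Φ (r₁ t) / √(2 * P₁) - Φ (r₂ t) / √(2 * P₂) =
      (Φ (r₁ t) - Φ (r₂ t)) * (1 / √(2 * P₁)) +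
        Φ (r₂ t) * (1 / √(2 * P₁) - 1 / √(2 * P₂)) := by ring
  rw [e]
  refine (abs_add_le _ _).trans ?_
  have h1 : |(Φ (r₁ t) - Φ (r₂ t)) * (1 / √(2 * P₁))| ≤ (K * d) * (1 / (m * √G)) := by
    rw [abs_mul, abs_of_nonneg (by positivity : 0 ≤ 1 / √(2 * P₁))]
    have h2 : |Φ (r₁ t) - Φ (r₂ t)| ≤ K * d :=
      (hK _ _).trans (mul_le_mul_of_nonneg_left (hd t) hK0)
    have h3 : m * √G ≤ √(2 * P₁) := by
      rw [← hsz]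
      exact Real.sqrt_le_sqrt (by linarith)
    gcongr
  have h2 : |Φ (r₂ t) * (1 / √(2 * P₁) - 1 / √(2 * P₂))| ≤
      M * ((4 * M * K * d * G) / (2 * (m ^ 2 * G) * (m * √G))) := by
    rw [abs_mul, abs_of_nonneg (hm.le.trans (hmΦ _))]
    have h3 := abs_one_div_sqrt_sub_le hz (x := 2 * P₁) (y := 2 * P₂) (by linarith) (by linarith)
    rw [hsz] at h3
    refine mul_le_mul (hΦM _) (h3.trans ?_) (abs_nonneg _) hM
    refine div_le_div_of_nonneg_right ?_ (by positivity)
    rw [← mul_sub, abs_mul, abs_two]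
    linarith
  refine (add_le_add h1 h2).trans ?_
  have e2 : (K * d) * (1 / (m * √G)) + M * ((4 * M * K * d * G) / (2 * (m ^ 2 * G) * (m * √G))) =
      (K / m + 2 * (M ^ 2 * K / m ^ 3)) * d * (1 / √G) := by
    field_simp; ring
  rw [e2]

theorem continuousOn_speed (hg : Continuous g) (hpos : ∀ s ∈ Ici a, 0 < g s)
    (hΦ : Continuous Φ) (hm : 0 < m) (hmΦ : ∀ x, m ≤ Φ x) {r : ℝ → ℝ} (hr : Continuous r) :
    ContinuousOn (fun t => Φ (r t) / √(2 * weightedPrimitive Φ g a r t)) (Ioi a) := by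
  have hP : Continuous (weightedPrimitive Φ g a r) :=
    continuous_iff_continuousAt.2 fun t => (hasDerivAt_weightedPrimitive hg hΦ hr t).continuousAt
  refine ContinuousOn.div (by fun_prop) (by fun_prop) fun t ht => ?_
  have h1 := le_weightedPrimitive hg hpos hΦ hm hmΦ hr (le_of_lt ht)
  have h2 := primitiveFrom_pos hg hpos ht
  have : 0 < weightedPrimitive Φ g a r t := (by positivity : 0 < m ^ 2 * _).trans_le h1
  positivity

theorem integrableOn_speed (hg : Continuous g) (hpos : ∀ s ∈ Ici a, 0 < g s)
    (hKO : KellerOsserman g a)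
    (hΦ : Continuous Φ) (hm : 0 < m) (hmΦ : ∀ x, m ≤ Φ x) (hΦM : ∀ x, Φ x ≤ M) {r : ℝ → ℝ}
    (hr : Continuous r) :
    IntegrableOn (fun t => Φ (r t) / √(2 * weightedPrimitive Φ g a r t)) (Ioi a) := by
  have h1 : IntegrableOn (fun t => M / m * (1 / √(primitiveFrom g a t))) (Ioi a) :=
    Integrable.const_mul hKO _
  refine Integrable.mono' h1
    ((continuousOn_speed hg hpos hΦ hm hmΦ hr).aestronglyMeasurable measurableSet_Ioi) ?_
  refine (ae_restrict_iff' measurableSet_Ioi).2 (.of_forall fun t ht => ?_)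
  rw [Real.norm_of_nonneg (div_nonneg (hm.le.trans (hmΦ _)) (Real.sqrt_nonneg _))]
  exact speed_le hg hpos hΦ hm hmΦ hΦM hr ht

/-- For a starting value `b` so large that the speed is a contraction, the equation
`r(t) = R - ∫_t^∞ Φ(r) / √(2 ∫_a^s Φ(r)² g) ds` has a solution on `[b, ∞)`. -/
theorem exists_radius_function (hg : Continuous g) (hpos : ∀ s ∈ Ici a, 0 < g s)
    (hKO : KellerOsserman g a) (hΦ : Continuous Φ) (hm : 0 < m) (hmΦ : ∀ x, m ≤ Φ x)
    (hΦM : ∀ x, Φ x ≤ M) (hK : ∀ x y, |Φ x - Φ y| ≤ K * |x - y|) (hK0 : 0 ≤ K) (R : ℝ) :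
    ∀ᶠ b in atTop, ∃ r : ℝ → ℝ, Continuous r ∧ ∀ t ≥ b,
      r t = R - ∫ s in Ioi t, Φ (r s) / √(2 * weightedPrimitive Φ g a r s) := by
  set C := K / m + 2 * (M ^ 2 * K / m ^ 3) with hC
  have hM : 0 ≤ M := (hm.le.trans (hmΦ 0)).trans (hΦM 0)
  have hC0 : 0 ≤ C := by positivity
  have hsmall := (tendsto_tail_zero g a).eventually
    (gt_mem_nhds (show (0 : ℝ) < 1 / (2 * (C + 1)) by positivity))
  filter_upwards [hsmall, eventually_gt_atTop a] with b hb hab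
  set I := ∫ s in Ioi b, 1 / √(primitiveFrom g a s) with hI
  have hI0 : 0 ≤ I := integral_nonneg fun s => by positivity
  have hCI : C * I ≤ 1 / 2 := by
    rw [lt_div_iff₀ (by positivity)] at hb
    nlinarith
  set k : (ℝ → ℝ) → ℝ → ℝ := fun r s => Φ (r s) / √(2 * weightedPrimitive Φ g a r s) with hk
  have hkint : ∀ r : ℝ → ℝ, Continuous r → ∀ t, b ≤ t → IntegrableOn (k r) (Ioi t) :=
    fun r hr t ht => (integrableOn_speed hg hpos hKO hΦ hm hmΦ hΦM hr).mono_set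
      (Ioi_subset_Ioi (hab.le.trans ht))
  have hk0 : ∀ r s, 0 ≤ k r s := fun r s => div_nonneg (hm.le.trans (hmΦ _)) (Real.sqrt_nonneg _)
  have hKOt : ∀ t, b ≤ t → IntegrableOn (fun s => 1 / √(primitiveFrom g a s)) (Ioi t) :=
    fun t ht => hKO.mono_set (Ioi_subset_Ioi (hab.le.trans ht))
  have hIt : ∀ t, b ≤ t → ∫ s in Ioi t, 1 / √(primitiveFrom g a s) ≤ I := fun t ht =>
    setIntegral_mono_set (hKOt b le_rfl) (.of_forall fun s => by positivity)
      (.of_forall (Ioi_subset_Ioi ht))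
  -- the fixed-point map
  let T : BoundedContinuousFunction ℝ ℝ → BoundedContinuousFunction ℝ ℝ := fun r =>
    BoundedContinuousFunction.ofNormedAddCommGroup
      (fun t => R - ∫ s in Ioi (max t b), k r s)
      (continuous_const.sub (continuous_integral_Ioi_max (hkint r r.continuous b le_rfl)))
      (|R| + M / m * I) (fun t => by
        refine (norm_sub_le _ _).trans (add_le_add le_rfl ?_)
        rw [Real.norm_of_nonneg (integral_nonneg fun s => hk0 r s)]
        have h1 : ∫ s in Ioi (max t b), k r s ≤
            ∫ s in Ioi (max t b), M / m * (1 / √(primitiveFrom g a s)) := by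
          refine setIntegral_mono_on (hkint r r.continuous _ (le_max_right _ _))
            ((hKOt _ (le_max_right _ _)).const_mul _) measurableSet_Ioi fun s hs => ?_
          exact speed_le hg hpos hΦ hm hmΦ hΦM r.continuous
            (hab.trans ((le_max_right t b).trans_lt hs))
        rw [integral_const_mul] at h1
        exact h1.trans (mul_le_mul_of_nonneg_left (hIt _ (le_max_right _ _)) (by positivity)))
  have hT : ContractingWith (1 / 2) T := by
    refine ⟨by rw [← NNReal.coe_lt_coe]; norm_num, LipschitzWith.of_dist_le_mul fun r₁ r₂ => ?_⟩
    refine (BoundedContinuousFunction.dist_le (by positivity)).2 fun t => ?_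
    have htb : b ≤ max t b := le_max_right _ _
    set t' := max t b
    have e : dist (T r₁ t) (T r₂ t) = |∫ s in Ioi t', (k r₂ s - k r₁ s)| := by
      rw [Real.dist_eq, integral_sub (hkint r₂ r₂.continuous _ htb) (hkint r₁ r₁.continuous _ htb)]
      congr 1
      change (R - ∫ s in Ioi t', k r₁ s) - (R - ∫ s in Ioi t', k r₂ s) = _
      ring
    rw [e]
    have h1 : |∫ s in Ioi t', (k r₂ s - k r₁ s)| ≤
        ∫ s in Ioi t', C * dist r₁ r₂ * (1 / √(primitiveFrom g a s)) := by
      rw [← Real.norm_eq_abs]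
      refine norm_integral_le_of_norm_le (μ := volume.restrict (Ioi t'))
        ((hKOt _ htb).const_mul (C * dist r₁ r₂)) ?_
      refine (ae_restrict_iff' measurableSet_Ioi).2 (.of_forall fun s hs => ?_)
      refine abs_speed_sub_le hg hpos hΦ hm hmΦ hΦM hK hK0 r₂.continuous r₁.continuous
        (fun s => ?_) (hab.trans (htb.trans_lt hs))
      rw [← Real.dist_eq, dist_comm]
      exact BoundedContinuousFunction.dist_coe_le_dist s
    rw [integral_const_mul] at h1
    refine h1.trans ?_
    have h2 := hIt t' htb
    have h3 : (0 : ℝ) ≤ dist r₁ r₂ := dist_nonneg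
    calc C * dist r₁ r₂ * ∫ s in Ioi t', 1 / √(primitiveFrom g a s) ≤ C * dist r₁ r₂ * I := by
          gcongr
      _ = C * I * dist r₁ r₂ := by ring
      _ ≤ 1 / 2 * dist r₁ r₂ := by gcongr
      _ = _ := by norm_num
  obtain ⟨r₀, hr₀⟩ : ∃ r₀ : BoundedContinuousFunction ℝ ℝ, T r₀ = r₀ :=
    ⟨_, ContractingWith.fixedPoint_isFixedPt hT⟩
  refine ⟨r₀, r₀.continuous, fun t ht => ?_⟩
  have h : (T r₀) t = R - ∫ s in Ioi (max t b), k r₀ s := rfl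
  rw [hr₀, max_eq_left ht] at h
  exact h

end FixedPoint

/-- A radial profile written in the phase plane, with its value `t` as the independent variable:
`r t` is the radius at which the value `t` is attained and `p t` is the slope there. The profile
tends to infinity at the radius `R`. Since its second derivative is `p' p`, the Laplacian of the
associated radial function on `ℝ^N` is `p' p + (N - 1) p / r`. -/
structure IsPhaseCurve (R b : ℝ) (r p p' : ℝ → ℝ) : Prop where
  r_pos : ∀ t > b, 0 < r t
  p_pos : ∀ t > b, 0 < p t
  hasDerivAt_r : ∀ t > b, HasDerivAt r (1 / p t) t
  hasDerivAt_p : ∀ t > b, HasDerivAt p (p' t) t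
  tendsto : Tendsto r atTop (𝓝 R)

section Existence

variable {g : ℝ → ℝ} {a R : ℝ}

/-- There is a radial solution in dimension `n + 1` that blows up exactly at the radius `R`; its
slope is negligible with respect to `g`. -/
theorem exists_phaseCurve (hg : Continuous g) (hpos : ∀ s ∈ Ici a, 0 < g s)
    (hconv : ConvexOn ℝ (Ici a) g) (hKO : KellerOsserman g a) (hR : 0 < R) (n : ℕ) {κ : ℝ}
    (hκ : 0 ≤ κ) :
    ∀ᶠ b in atTop, ∃ r p : ℝ → ℝ, IsPhaseCurve R b r p (fun t => g t / p t - n / r t) ∧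
      (∀ t > b, R / 2 ≤ r t) ∧ (∀ t > b, κ * p t ≤ g t) ∧
      IntegrableOn (fun t => 1 / p t) (Ioi b) := by
  -- the weight `r ^ n`, truncated to `[R / 2, R]` so as to be bounded, positive and Lipschitz
  set cl : ℝ → ℝ := fun x => max (R / 2) (min x R) with hcl
  set Φ : ℝ → ℝ := fun x => cl x ^ n with hΦdef
  set m := (R / 2) ^ n with hm
  set M := R ^ n with hM
  have hcl1 : ∀ x, R / 2 ≤ cl x := fun x => le_max_left _ _
  have hcl2 : ∀ x, cl x ≤ R := fun x => max_le (by linarith) (min_le_right _ _)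
  have hΦ : Continuous Φ := by simp only [hΦdef, hcl]; fun_prop
  have hm0 : 0 < m := by positivity
  have hM0 : 0 < M := by positivity
  have hmΦ : ∀ x, m ≤ Φ x := fun x => pow_le_pow_left₀ (by positivity) (hcl1 x) n
  have hΦM : ∀ x, Φ x ≤ M := fun x =>
    pow_le_pow_left₀ ((by positivity : 0 ≤ R / 2).trans (hcl1 x)) (hcl2 x) n
  have hK0 : 0 ≤ n * R ^ (n - 1) := by positivity
  have hK : ∀ x y, |Φ x - Φ y| ≤ n * R ^ (n - 1) * |x - y| := fun x y => by
    have h1 : |cl x - cl y| ≤ |x - y| := by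
      refine (abs_max_sub_max_le_max _ _ _ _).trans (max_le (by simp) ?_)
      refine (abs_min_sub_min_le_max _ _ _ _).trans (max_le le_rfl (by simp))
    have h2 : max |cl x| |cl y| ≤ R := by
      rw [abs_of_nonneg ((by positivity : 0 ≤ R / 2).trans (hcl1 x)),
        abs_of_nonneg ((by positivity : 0 ≤ R / 2).trans (hcl1 y))]
      exact max_le (hcl2 x) (hcl2 y)
    calc |Φ x - Φ y| ≤ |cl x - cl y| * n * max |cl x| |cl y| ^ (n - 1) := abs_pow_sub_pow_le ..
      _ ≤ |x - y| * n * R ^ (n - 1) := by gcongr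
      _ = _ := by ring
  -- the slope is comparable to `√G`
  set C := 2 * M / m with hC
  have hsmall := (tendsto_tail_zero g a).eventually
    (gt_mem_nhds (show (0 : ℝ) < R / 2 / (M / m) by positivity))
  filter_upwards [exists_radius_function hg hpos hKO hΦ hm0 hmΦ hΦM hK hK0 R, hsmall,
    eventually_gt_atTop a, eventually_forall_ge_atTop.2
      (eventually_mul_sqrt_primitiveFrom_le hg hpos hconv hKO (κ * C))] with b hb1 hb2 hab hb3
  obtain ⟨r, hrc, hr⟩ := hb1
  set P := weightedPrimitive Φ g a r with hPdef
  set k : ℝ → ℝ := fun s => Φ (r s) / √(2 * P s) with hk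
  have hk0 : ∀ s, 0 ≤ k s := fun s => div_nonneg (hm0.le.trans (hmΦ _)) (Real.sqrt_nonneg _)
  have hkint : IntegrableOn k (Ioi a) := integrableOn_speed hg hpos hKO hΦ hm0 hmΦ hΦM hrc
  have hkb : ∀ t ≥ b, IntegrableOn k (Ioi t) := fun t ht =>
    hkint.mono_set (Ioi_subset_Ioi (hab.le.trans ht))
  have hkc : ContinuousOn k (Ioi b) :=
    (continuousOn_speed hg hpos hΦ hm0 hmΦ hrc).mono (Ioi_subset_Ioi hab.le)
  have hP0 : ∀ t > b, 0 < P t := fun t ht => by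
    have h1 := primitiveFrom_pos hg hpos (hab.trans ht)
    exact (by positivity : 0 < m ^ 2 * _).trans_le
      (le_weightedPrimitive hg hpos hΦ hm0 hmΦ hrc (hab.trans ht).le)
  have hrR : ∀ t ≥ b, r t ≤ R := fun t ht => by
    rw [hr t ht]
    linarith [setIntegral_nonneg (μ := volume) measurableSet_Ioi fun s (_ : s ∈ Ioi t) => hk0 s]
  have hrl : ∀ t ≥ b, R / 2 ≤ r t := fun t ht => by
    have h1 : ∫ s in Ioi t, k s ≤ ∫ s in Ioi b, k s :=
      setIntegral_mono_set (hkb b le_rfl) (.of_forall hk0) (.of_forall (Ioi_subset_Ioi ht))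
    have h2 : ∫ s in Ioi b, k s ≤ ∫ s in Ioi b, M / m * (1 / √(primitiveFrom g a s)) := by
      refine setIntegral_mono_on (hkb b le_rfl)
        ((hKO.mono_set (Ioi_subset_Ioi hab.le)).const_mul _) measurableSet_Ioi fun s hs => ?_
      exact speed_le hg hpos hΦ hm0 hmΦ hΦM hrc (hab.trans hs)
    rw [integral_const_mul] at h2
    rw [lt_div_iff₀ (by positivity)] at hb2
    rw [hr t ht]
    linarith
  have hr0 : ∀ t ≥ b, 0 < r t := fun t ht => (by positivity : 0 < R / 2).trans_le (hrl t ht)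
  have hΦr : ∀ t ≥ b, Φ (r t) = r t ^ n := fun t ht => by
    simp only [hΦdef, hcl]
    rw [min_eq_left (hrR t ht), max_eq_right (hrl t ht)]
  set p : ℝ → ℝ := fun t => √(2 * P t) / r t ^ n with hp
  have hsq0 : ∀ t > b, 0 < √(2 * P t) := fun t ht =>
    Real.sqrt_pos.2 (mul_pos two_pos (hP0 t ht))
  have hkp : ∀ t > b, k t = 1 / p t := fun t ht => by
    simp only [hk, hp]
    rw [hΦr t (le_of_lt ht), one_div_div]
  have hp0 : ∀ t > b, 0 < p t := fun t ht =>
    div_pos (hsq0 t ht) (pow_pos (hr0 t (le_of_lt ht)) n)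
  have hdr : ∀ t > b, HasDerivAt r (1 / p t) t := fun t ht => by
    have h1 := (hasDerivAt_integral_Ioi hkc (hkb b le_rfl) ht).const_sub R
    rw [neg_neg, hkp t ht] at h1
    refine h1.congr_of_eventuallyEq ?_
    filter_upwards [lt_mem_nhds ht] with s hs using hr s (le_of_lt hs)
  refine ⟨r, p, ⟨fun t ht => hr0 t (le_of_lt ht), hp0, hdr, fun t ht => ?_, ?_⟩,
    fun t ht => hrl t (le_of_lt ht), fun t ht => ?_, ?_⟩
  · have hrt := hr0 t (le_of_lt ht)
    have hs := hsq0 t ht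
    have h1 := ((hasDerivAt_weightedPrimitive (a := a) hg hΦ hrc t).const_mul 2).sqrt
      (mul_pos two_pos (hP0 t ht)).ne'
    have h2 := h1.div ((hdr t ht).pow n) (pow_pos hrt n).ne'
    refine h2.congr_deriv ?_
    have e1 : (n : ℝ) * r t ^ (n - 1) = n * r t ^ n / r t := by
      rcases n with _ | n
      · simp
      · rw [Nat.add_sub_cancel, pow_succ]; field_simp
    change (2 * (Φ (r t) ^ 2 * g t) / (2 * √(2 * P t)) * r t ^ n -
      √(2 * P t) * (n * r t ^ (n - 1) * (1 / p t))) / (r t ^ n) ^ 2 = g t / p t - n / r t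
    rw [hΦr t (le_of_lt ht), e1]
    simp only [hp]
    field_simp
  · have h1 : Tendsto (fun t => R - ∫ s in Ioi t, k s) atTop (𝓝 (R - 0)) :=
      (tendsto_integral_Ioi_zero tendsto_id).const_sub R
    rw [sub_zero] at h1
    refine h1.congr' ?_
    filter_upwards [eventually_ge_atTop b] with t ht using (hr t ht).symm
  · have hG := primitiveFrom_pos hg hpos (hab.trans ht)
    have h1 : √(2 * P t) ≤ 2 * M * √(primitiveFrom g a t) := by
      refine Real.sqrt_le_iff.2 ⟨by positivity, ?_⟩
      rw [mul_pow, Real.sq_sqrt hG.le]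
      have := weightedPrimitive_le hg hpos hΦ hm0 hmΦ hΦM hrc (hab.trans ht).le
      nlinarith [mul_pos (pow_pos hM0 2) hG]
    have h2 : p t ≤ C * √(primitiveFrom g a t) := by
      rw [hC, div_mul_eq_mul_div]
      refine div_le_div₀ (by positivity) h1 hm0 ?_
      rw [← hΦr t (le_of_lt ht)]
      exact hmΦ _
    calc κ * p t ≤ κ * (C * √(primitiveFrom g a t)) := by gcongr
      _ = κ * C * √(primitiveFrom g a t) := by ring
      _ ≤ g t := hb3 t (le_of_lt ht)
  · exact (hkb b le_rfl).congr_fun hkp measurableSet_Ioi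

end Existence

/-! ### Radial profiles and comparison with them -/

/-- The radial profile of a phase curve, that is, the inverse function of `r`; it is meaningful on
`r '' Ioi b`. -/
noncomputable def radialProfile (b : ℝ) (r : ℝ → ℝ) : ℝ → ℝ :=
  Function.invFunOn r (Ioi b)

namespace IsPhaseCurve

variable {R b : ℝ} {r p p' : ℝ → ℝ}

theorem strictMonoOn (h : IsPhaseCurve R b r p p') : StrictMonoOn r (Ioi b) := by
  refine strictMonoOn_of_deriv_pos (convex_Ioi b)
    (fun t ht => (h.hasDerivAt_r t ht).continuousAt.continuousWithinAt) fun t ht => ?_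
  rw [interior_Ioi] at ht
  rw [(h.hasDerivAt_r t ht).deriv]
  exact one_div_pos.2 (h.p_pos t ht)

theorem r_lt (h : IsPhaseCurve R b r p p') {t : ℝ} (ht : b < t) : r t < R := by
  have h1 : r t < r (t + 1) :=
    h.strictMonoOn (mem_Ioi.2 ht) (mem_Ioi.2 (by linarith)) (lt_add_one t)
  refine h1.trans_le (ge_of_tendsto h.tendsto ?_)
  filter_upwards [eventually_ge_atTop (t + 1)] with s hs
  exact h.strictMonoOn.monotoneOn (mem_Ioi.2 (by linarith)) (mem_Ioi.2 (by linarith)) hs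

theorem exists_eq (h : IsPhaseCurve R b r p p') {t ρ : ℝ} (ht : b < t) (h1 : r t ≤ ρ)
    (h2 : ρ < R) : ∃ s, t ≤ s ∧ r s = ρ := by
  obtain ⟨T, hT1, hT2⟩ := ((h.tendsto.eventually (lt_mem_nhds h2)).and
    (eventually_ge_atTop t)).exists
  have hc : ContinuousOn r (Icc t T) := fun s hs =>
    (h.hasDerivAt_r s (ht.trans_le hs.1)).continuousAt.continuousWithinAt
  obtain ⟨s, hs, rfl⟩ := intermediate_value_Icc hT2 hc ⟨h1, hT1.le⟩
  exact ⟨s, hs.1, rfl⟩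

theorem profile_apply (h : IsPhaseCurve R b r p p') {t : ℝ} (ht : b < t) :
    radialProfile b r (r t) = t :=
  h.strictMonoOn.injOn.leftInvOn_invFunOn (mem_Ioi.2 ht)

theorem continuousAt_profile (h : IsPhaseCurve R b r p p') {t : ℝ} (ht : b < t) :
    ContinuousAt (radialProfile b r) (r t) := by
  have hmono : StrictMonoOn (radialProfile b r) (r '' Ioi b) := by
    rintro _ ⟨x, hx, rfl⟩ _ ⟨y, hy, rfl⟩ hxy
    rw [h.profile_apply hx, h.profile_apply hy]
    exact (h.strictMonoOn.lt_iff_lt hx hy).1 hxy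
  refine hmono.continuousAt_of_image_mem_nhds ?_ ?_
  · have h1 : b < (b + t) / 2 := by linarith
    have h2 : r ((b + t) / 2) < r t := h.strictMonoOn h1 ht (by linarith)
    filter_upwards [Ioo_mem_nhds h2 (h.r_lt ht)] with ρ hρ
    obtain ⟨s, hs, rfl⟩ := h.exists_eq h1 hρ.1.le hρ.2
    exact ⟨s, h1.trans_le hs, rfl⟩
  · rw [h.profile_apply ht]
    filter_upwards [lt_mem_nhds ht] with s hs
    exact ⟨r s, ⟨s, hs, rfl⟩, h.profile_apply hs⟩

theorem eventually_exists_eq (h : IsPhaseCurve R b r p p') {t : ℝ} (ht : b < t) :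
    ∀ᶠ ρ in 𝓝 (r t), ∃ s > b, r s = ρ := by
  have h1 : b < (b + t) / 2 := by linarith
  have h2 : r ((b + t) / 2) < r t := h.strictMonoOn h1 ht (by linarith)
  filter_upwards [Ioo_mem_nhds h2 (h.r_lt ht)] with ρ hρ
  obtain ⟨s, hs, rfl⟩ := h.exists_eq h1 hρ.1.le hρ.2
  exact ⟨s, h1.trans_le hs, rfl⟩

theorem hasDerivAt_profile (h : IsPhaseCurve R b r p p') {t : ℝ} (ht : b < t) :
    HasDerivAt (radialProfile b r) (p t) (r t) := by
  have h1 : HasDerivAt r (1 / p t) (radialProfile b r (r t)) := by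
    rw [h.profile_apply ht]; exact h.hasDerivAt_r t ht
  have h2 := HasDerivAt.of_local_left_inverse (h.continuousAt_profile ht) h1
    (one_div_pos.2 (h.p_pos t ht)).ne' ?_
  · simpa using h2
  · filter_upwards [h.eventually_exists_eq ht] with ρ hρ
    obtain ⟨s, hs, rfl⟩ := hρ
    rw [h.profile_apply hs]

/-- The second derivative of the profile. -/
theorem hasDerivAt_slope (h : IsPhaseCurve R b r p p') {t : ℝ} (ht : b < t) :
    HasDerivAt (fun ρ => p (radialProfile b r ρ)) (p' t * p t) (r t) := by
  refine HasDerivAt.comp (r t) (h₂ := p) ?_ (h.hasDerivAt_profile ht)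
  rw [h.profile_apply ht]
  exact h.hasDerivAt_p t ht

/-- First and second derivatives of the profile composed with the dilation of ratio `l` about the
point `2R`. The dilated profile blows up outside the ball if `l > 1` and inside it if `l < 1`. -/
theorem hasDerivAt_profile_dilation (h : IsPhaseCurve R b r p p') {t l s : ℝ} (ht : b < t)
    (hs : 2 * R - l * (2 * R - s) = r t) :
    (∀ᶠ σ in 𝓝 s, HasDerivAt (fun σ => radialProfile b r (2 * R - l * (2 * R - σ)))
      (l * p (radialProfile b r (2 * R - l * (2 * R - σ)))) σ) ∧
    HasDerivAt (fun σ => l * p (radialProfile b r (2 * R - l * (2 * R - σ))))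
      (l * (p' t * p t * l)) s := by
  have hd : ∀ σ, HasDerivAt (fun σ => 2 * R - l * (2 * R - σ)) l σ := fun σ => by
    have := (((hasDerivAt_id σ).const_sub (2 * R)).const_mul l).const_sub (2 * R)
    refine this.congr_deriv (by ring)
  constructor
  · have h1 : Tendsto (fun σ => 2 * R - l * (2 * R - σ)) (𝓝 s) (𝓝 (r t)) := by
      rw [← hs]; exact (hd s).continuousAt.tendsto
    filter_upwards [h1.eventually (h.eventually_exists_eq ht)] with σ hσ
    obtain ⟨τ, hτ, hτσ⟩ := hσ
    have h2 := h.hasDerivAt_profile hτ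
    rw [hτσ] at h2
    refine (h2.comp σ (hd σ)).congr_deriv ?_
    rw [← hτσ, h.profile_apply hτ]; ring
  · have h2 := h.hasDerivAt_slope ht
    rw [← hs] at h2
    exact (h2.comp s (hd s)).const_mul l

theorem hasDerivAt_profile_eventually (h : IsPhaseCurve R b r p p') {t : ℝ} (ht : b < t) :
    ∀ᶠ σ in 𝓝 (r t), HasDerivAt (radialProfile b r) (p (radialProfile b r σ)) σ := by
  filter_upwards [h.eventually_exists_eq ht] with σ hσ
  obtain ⟨τ, hτ, rfl⟩ := hσ
  rw [h.profile_apply hτ]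
  exact h.hasDerivAt_profile hτ

theorem tendsto_profile_dilation (h : IsPhaseCurve R b r p p') {t : ℝ} (ht : b < t) :
    Tendsto (fun l : ℝ => radialProfile b r (2 * R - l * (2 * R - r t))) (𝓝 1)
      (𝓝 (radialProfile b r (r t))) := by
  refine (h.continuousAt_profile ht).tendsto.comp ?_
  have hc : ContinuousAt (fun l : ℝ => 2 * R - l * (2 * R - r t)) 1 := by fun_prop
  simpa using hc.tendsto

end IsPhaseCurve

/-- The error produced in the first-order term of the radial Laplacian by a dilation of ratio `l`
about the point `2R` is dominated by the gain in the second-order term. -/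
theorem dilation_error_le {R n κ l q G ρ s : ℝ} (hR : 0 < R) (hn : 0 ≤ n) (hl : 0 < l)
    (hq : 0 ≤ q) (hκ : 8 * n / R ≤ κ) (hG : κ * q ≤ G) (hρ : R / 2 ≤ ρ) (hs : R / 2 ≤ s) :
    n * l * q * (2 * R) / (ρ * s) ≤ (1 + l) * G := by
  have hG0 : 0 ≤ G := (mul_nonneg ((by positivity : (0 : ℝ) ≤ 8 * n / R).trans hκ) hq).trans hG
  have h1 : R / 2 * (R / 2) ≤ ρ * s := mul_le_mul hρ hs (by positivity) (by linarith)
  calc n * l * q * (2 * R) / (ρ * s) ≤ n * l * q * (2 * R) / (R / 2 * (R / 2)) := by gcongr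
    _ = l * (8 * n / R * q) := by field_simp; norm_num
    _ ≤ l * (κ * q) := by gcongr
    _ ≤ l * G := by gcongr
    _ ≤ (1 + l) * G := by linarith

section Comparison

variable {N : ℕ} {g : ℝ → ℝ} {R a b κ : ℝ} {u : EuclideanSpace ℝ (Fin N) → ℝ}
  {r p p' r₂ p₂ p₂' d : ℝ → ℝ}

/-- A dilated subsolution stays below a large solution. The hypotheses bound the drag term of the
subsolution from below by `(N - 1) d`, where `d` is small compared to `g`; the slope `p` itself need
not be small. -/
theorem profile_dilation_le (hN : 0 < N) (hR : 0 < R) (hmono : StrictMonoOn g (Ici b))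
    (hu : IsLargeSolution g R u) (h : IsPhaseCurve R b r p p')
    (hsub : ∀ t > b, g t ≤ p' t * p t + (N - 1) * d t) (hd0 : ∀ t > b, 0 ≤ d t)
    (hd : ∀ t > b, d t ≤ p t / r t) (hg : ∀ t > b, 4 * (((N : ℝ) - 1) * d t) ≤ g t) {b₂ : ℝ}
    (hb : b < b₂) (hhalf : R / 2 ≤ r b₂)
    (hub : ∀ x : EuclideanSpace ℝ (Fin N), ‖x‖ < R → r b₂ ≤ ‖x‖ → b₂ ≤ u x) {l : ℝ} (hl : 1 < l)
    {x : EuclideanSpace ℝ (Fin N)} (hx : ‖x‖ < R) (hxb : r b₂ < 2 * R - l * (2 * R - ‖x‖)) :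
    radialProfile b r (2 * R - l * (2 * R - ‖x‖)) ≤ u x := by
  set V := radialProfile b r with hV
  set ρ : ℝ → ℝ := fun s => 2 * R - l * (2 * R - s) with hρ
  have hρlt : ∀ s, s ≤ R → ρ s < s := fun s hs => by simp only [hρ]; nlinarith
  have hρmono : ∀ s s', s ≤ s' → ρ s ≤ ρ s' := fun s s' hss => by simp only [hρ]; nlinarith
  have hN1 : (0 : ℝ) ≤ (N : ℝ) - 1 := by
    have : (1 : ℝ) ≤ N := by exact_mod_cast hN
    linarith
  by_contra! hneg
  -- near the boundary of the ball the dilated profile is bounded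
  obtain ⟨tR, htR, htR'⟩ := h.exists_eq hb (hxb.le.trans (hρmono _ R hx.le)) (hρlt R le_rfl)
  obtain ⟨δ, hδ, hbl⟩ := hu.blowup tR
  have hpar : ∀ s, s < R → r b₂ ≤ ρ s → ∃ t, b₂ ≤ t ∧ r t = ρ s := fun s hs hs' =>
    h.exists_eq hb hs' ((hρlt s hs.le).trans hs)
  have hbd : ∀ y : EuclideanSpace ℝ (Fin N), ‖y‖ < R → r b₂ ≤ ρ ‖y‖ → R - δ < ‖y‖ →
      V (ρ ‖y‖) < u y := fun y h1 h2 h3 => by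
    obtain ⟨t, ht, ht'⟩ := hpar _ h1 h2
    rw [← ht', hV, h.profile_apply (hb.trans_le ht)]
    refine lt_of_le_of_lt ?_ (hbl y (by simpa using h1) h3)
    refine (h.strictMonoOn.le_iff_le (hb.trans_le ht) (hb.trans_le htR)).1 ?_
    rw [ht', htR']
    exact hρmono _ _ h1.le
  set C : Set (EuclideanSpace ℝ (Fin N)) :=
    {y | y ∈ Metric.closedBall 0 (R - δ) ∧ r b₂ ≤ ρ ‖y‖} with hC
  have hCR : ∀ y ∈ C, ‖y‖ < R := fun y hy => by
    have : ‖y‖ ≤ R - δ := by simpa using hy.1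
    linarith
  have hCc : IsCompact C := (isCompact_closedBall 0 (R - δ)).inter_right
    (isClosed_le (f := fun _ => r b₂) (g := fun y => ρ ‖y‖) continuous_const
      (by simp only [hρ]; fun_prop))
  have hcont : ContinuousOn (fun y => u y - V (ρ ‖y‖)) C := fun y hy => by
    obtain ⟨t, ht, ht'⟩ := hpar _ (hCR y hy) hy.2
    refine ((hu.contDiffAt (hCR y hy)).continuousAt.sub ?_).continuousWithinAt
    refine ContinuousAt.comp (g := V) (f := fun y => ρ ‖y‖) ?_
      (Continuous.continuousAt (by simp only [hρ]; fun_prop))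
    rw [← ht']
    exact h.continuousAt_profile (hb.trans_le ht)
  have hxC : x ∈ C := by
    refine ⟨?_, hxb.le⟩
    by_contra hc
    exact (hbd x hx hxb.le (by simpa using hc)).not_gt hneg
  obtain ⟨y, hyC, hymin⟩ := hCc.exists_isMinOn ⟨x, hxC⟩ hcont
  have hyR := hCR y hyC
  have hyneg : u y - V (ρ ‖y‖) < 0 := lt_of_le_of_lt (hymin hxC) (by linarith)
  have hyb : r b₂ ≤ ‖y‖ := hyC.2.trans (hρlt _ hyR.le).le
  have hby := hub y hyR hyb
  obtain ⟨t, ht, ht'⟩ := hpar _ hyR hyC.2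
  have hbt : b < t := hb.trans_le ht
  have hVt : V (ρ ‖y‖) = t := by rw [← ht', hV, h.profile_apply hbt]
  rw [hVt] at hyneg
  have hyb' : r b₂ < ρ ‖y‖ := by
    rw [← ht']
    exact h.strictMonoOn hb hbt (by linarith)
  have hloc : IsLocalMin (fun z => u z - V (ρ ‖z - 0‖)) y := by
    have h1 : ∀ᶠ z in 𝓝 y, ‖z‖ < R :=
      (show ContinuousAt (fun z => ‖z‖) y by fun_prop).eventually_lt continuousAt_const hyR
    have h2 : ∀ᶠ z in 𝓝 y, r b₂ < ρ ‖z‖ := continuousAt_const.eventually_lt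
      (show ContinuousAt (fun z => ρ ‖z‖) y by simp only [hρ]; fun_prop) hyb'
    filter_upwards [h1, h2] with z h1 h2
    rw [sub_zero, sub_zero]
    by_cases hz : z ∈ C
    · exact hymin hz
    · have := hbd z h1 h2.le (by
        by_contra hc
        exact hz ⟨by simpa using hc, h2.le⟩)
      rw [hVt]
      linarith
  have hy0 : y ≠ 0 := by
    rintro rfl
    rw [norm_zero] at hyb
    linarith [h.r_pos b₂ hb]
  obtain ⟨d1, d2⟩ := h.hasDerivAt_profile_dilation (s := ‖y - 0‖) (l := l) hbt
    (by rw [sub_zero]; exact ht'.symm)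
  have key := radial_le_laplacian_of_isLocalMin hN (hu.contDiffAt hyR) hy0 d1 d2 hloc
  rw [sub_zero, hu.laplacian_eq hyR] at key
  change _ + ((N : ℝ) - 1) * (l * p (V (ρ ‖y‖)) / ‖y‖) ≤ _ at key
  rw [hVt] at key
  have hlt : g (u y) < g t := hmono (mem_Ici.2 (hb.le.trans hby)) (mem_Ici.2 hbt.le) (by linarith)
  have hrt := h.r_pos t hbt
  have hy1 : 0 < ‖y‖ := norm_pos_iff.2 hy0
  have hyR2 : R / 2 ≤ ‖y‖ := hhalf.trans hyb
  have hD := hd0 t hbt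
  -- the error of the first-order term is dominated by the gain in the second-order term
  have herr : ((N : ℝ) - 1) * l * d t * (2 * R) / ‖y‖ ≤ (1 + l) * g t := by
    have hD' : 0 ≤ ((N : ℝ) - 1) * d t := mul_nonneg hN1 hD
    have hG := hg t hbt
    calc ((N : ℝ) - 1) * l * d t * (2 * R) / ‖y‖
        ≤ ((N : ℝ) - 1) * l * d t * (2 * R) / (R / 2) := by
          gcongr
      _ = l * (4 * (((N : ℝ) - 1) * d t)) := by field_simp; norm_num
      _ ≤ l * g t := by gcongr
      _ ≤ (1 + l) * g t := by nlinarith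
  have hs := hsub t hbt
  have hdp : ((N : ℝ) - 1) * (l * (d t * r t) / ‖y‖) ≤ (N - 1) * (l * p t / ‖y‖) := by
    have := (le_div_iff₀ hrt).1 (hd t hbt)
    gcongr
  have e1 : l ^ 2 * (((N : ℝ) - 1) * d t) - (N - 1) * (l * (d t * r t) / ‖y‖) =
      (l - 1) * ((N - 1) * l * d t * (2 * R) / ‖y‖) := by
    have : 2 * R * (l - 1) = l * ‖y‖ - r t := by rw [ht']; simp only [hρ]; ring
    field_simp
    linear_combination (-(N - 1 : ℝ)) * d t * this
  have h2 := mul_le_mul_of_nonneg_left herr (by linarith : 0 ≤ l - 1)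
  have h3 := mul_le_mul_of_nonneg_left hs (by positivity : 0 ≤ l ^ 2)
  nlinarith

/-- A subsolution that blows up on the boundary stays below a large solution: let the ratio of the
dilation tend to `1`. -/
theorem profile_le (hN : 0 < N) (hR : 0 < R) (hmono : StrictMonoOn g (Ici b))
    (hu : IsLargeSolution g R u) (h : IsPhaseCurve R b r p p')
    (hsub : ∀ t > b, g t ≤ p' t * p t + (N - 1) * d t) (hd0 : ∀ t > b, 0 ≤ d t)
    (hd : ∀ t > b, d t ≤ p t / r t) (hg : ∀ t > b, 4 * (((N : ℝ) - 1) * d t) ≤ g t) {b₂ : ℝ}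
    (hb : b < b₂) (hhalf : R / 2 ≤ r b₂)
    (hub : ∀ x : EuclideanSpace ℝ (Fin N), ‖x‖ < R → r b₂ ≤ ‖x‖ → b₂ ≤ u x)
    {x : EuclideanSpace ℝ (Fin N)} (hx : ‖x‖ < R) (hxb : r b₂ < ‖x‖) :
    radialProfile b r ‖x‖ ≤ u x := by
  obtain ⟨t, ht, ht'⟩ := h.exists_eq hb hxb.le hx
  have h1 := h.tendsto_profile_dilation (hb.trans_le ht)
  rw [ht'] at h1
  refine le_of_tendsto (h1.mono_left (nhdsWithin_le_nhds (s := Ioi 1))) ?_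
  have h4 : ∀ᶠ l in 𝓝 (1 : ℝ), r b₂ < 2 * R - l * (2 * R - ‖x‖) :=
    continuousAt_const.eventually_lt
      (show ContinuousAt (fun l : ℝ => 2 * R - l * (2 * R - ‖x‖)) 1 by fun_prop)
      (by rwa [one_mul, sub_sub_cancel])
  filter_upwards [self_mem_nhdsWithin, h4.filter_mono nhdsWithin_le_nhds] with l hl hl'
  exact profile_dilation_le hN hR hmono hu h hsub hd0 hd hg hb hhalf hub hl hx hl'

/-- A phase curve with larger radii has a smaller profile. -/
theorem profile_lt_profile (h : IsPhaseCurve R b r p p') (h₂ : IsPhaseCurve R b r₂ p₂ p₂')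
    (hrr : ∀ t > b, r t < r₂ t) {t : ℝ} (ht : b < t) :
    ∃ s > t, r s = r₂ t := by
  obtain ⟨s, hs, hs'⟩ := h.exists_eq ht (hrr t ht).le (h₂.r_lt ht)
  refine ⟨s, lt_of_le_of_ne hs ?_, hs'⟩
  rintro rfl
  exact (hrr t ht).ne hs'

set_option maxHeartbeats 1000000 in
/-- A large solution stays below a dilated supersolution `V`, corrected by a multiple of the
difference of `V` and a smaller subsolution `V₂`. The sum `φ` is again a supersolution: at a radius
where the dilation of `V`, `V` and `V₂` have the values `t₀ > τ > σ`, convexity gives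
`g t₀ + A (g τ - g σ) ≤ g (t₀ + A (τ - σ))`. -/
theorem le_profile_dilation (hN : 0 < N) (hR : 0 < R) (hab : a ≤ b)
    (hconv : ConvexOn ℝ (Ici a) g) (hmono : StrictMonoOn g (Ici b))
    (hu : IsLargeSolution g R u) (h : IsPhaseCurve R b r p p') (h₂ : IsPhaseCurve R b r₂ p₂ p₂')
    (hsup : ∀ t > b, p' t * p t + (N - 1) * (p t / r t) ≤ g t)
    (hsub : ∀ t > b, g t ≤ p₂' t * p₂ t + (N - 1) * (p₂ t / r₂ t))
    (hrr : ∀ t > b, r t < r₂ t) (hhalf : ∀ t > b, R / 2 ≤ r t)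
    (hκ : 8 * ((N : ℝ) - 1) / R ≤ κ) (hg : ∀ t > b, κ * p t ≤ g t) {t₁ A : ℝ} (ht₁ : b < t₁)
    (hA : 0 ≤ A)
    (hub : ∀ x : EuclideanSpace ℝ (Fin N), ‖x‖ = r₂ t₁ → u x ≤ radialProfile b r (r₂ t₁) +
      A * (radialProfile b r (r₂ t₁) - radialProfile b r₂ (r₂ t₁)))
    {l : ℝ} (hl0 : 0 < l) (hl : l < 1)
    {x : EuclideanSpace ℝ (Fin N)} (hx : r₂ t₁ ≤ ‖x‖) (hxR : 2 * R - l * (2 * R - ‖x‖) < R) :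
    u x ≤ radialProfile b r (2 * R - l * (2 * R - ‖x‖)) +
      A * (radialProfile b r ‖x‖ - radialProfile b r₂ ‖x‖) := by
  set V := radialProfile b r with hV
  set V₂ := radialProfile b r₂ with hV₂
  set ρ : ℝ → ℝ := fun s => 2 * R - l * (2 * R - s) with hρ
  set φ : ℝ → ℝ := fun s => V (ρ s) + A * (V s - V₂ s) with hφ
  have hρlt : ∀ s, s ≤ R → s < ρ s := fun s hs => by simp only [hρ]; nlinarith
  have hN1 : (0 : ℝ) ≤ (N : ℝ) - 1 := by
    have : (1 : ℝ) ≤ N := by exact_mod_cast hN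
    linarith
  have hsR : ∀ s, ρ s < R → s < R := fun s hs => by
    by_contra! hc
    simp only [hρ] at hs
    nlinarith
  by_contra! hneg
  -- the values at a radius `s` of the dilation of `V`, of `V` and of `V₂`
  have hpar : ∀ s, r₂ t₁ ≤ s → ρ s < R → ∃ t₀ τ σ, b < σ ∧ t₁ ≤ σ ∧ σ < τ ∧ τ < t₀ ∧ r t₀ = ρ s ∧
      r τ = s ∧ r₂ σ = s := fun s hs hs' => by
    obtain ⟨σ, hσ, hσ'⟩ := h₂.exists_eq ht₁ hs (hsR s hs')
    obtain ⟨τ, hτ, hτ'⟩ := profile_lt_profile h h₂ hrr (ht₁.trans_le hσ)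
    have hbτ : b < τ := (ht₁.trans_le hσ).trans hτ
    obtain ⟨t₀, ht₀, ht₀'⟩ := h.exists_eq hbτ (t := τ) (ρ := ρ s)
      (by rw [hτ', hσ']; exact (hρlt s (hsR s hs').le).le) hs'
    refine ⟨t₀, τ, σ, ht₁.trans_le hσ, hσ, hτ, lt_of_le_of_ne ht₀ ?_, ht₀', by rw [hτ', hσ'], hσ'⟩
    rintro rfl
    rw [hτ', hσ'] at ht₀'
    exact (hρlt s (hsR s hs').le).ne ht₀'
  have hval : ∀ {s t₀ τ σ : ℝ}, b < σ → σ < τ → τ < t₀ → r t₀ = ρ s → r τ = s → r₂ σ = s →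
      φ s = t₀ + A * (τ - σ) := fun {s t₀ τ σ} h0 h1 h2 h3 h4 h5 => by
    have e1 : V (ρ s) = t₀ := by rw [← h3, hV, h.profile_apply ((h0.trans h1).trans h2)]
    have e2 : V s = τ := by rw [← h4, hV, h.profile_apply (h0.trans h1)]
    have e3 : V₂ s = σ := by rw [← h5, hV₂, h₂.profile_apply h0]
    simp only [hφ, e1, e2, e3]
  -- an upper bound of `u` on the ball where the dilated profile is finite
  set R' := 2 * R - R / l with hR'
  have hρR' : ∀ s, ρ s ≤ R ↔ s ≤ R' := fun s => by
    simp only [hρ, hR']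
    rw [show R / l = R * l⁻¹ from rfl]
    have hi : l * l⁻¹ = 1 := mul_inv_cancel₀ hl0.ne'
    have hi0 : 0 < l⁻¹ := inv_pos.2 hl0
    constructor
    · intro hs
      have := mul_le_mul_of_nonneg_left hs hi0.le
      have e : l⁻¹ * (2 * R - l * (2 * R - s)) = l⁻¹ * (2 * R) - (l * l⁻¹) * (2 * R - s) := by ring
      rw [e, hi] at this
      linarith
    · intro hs
      have := mul_le_mul_of_nonneg_left hs hl0.le
      have e : l * (2 * R - R * l⁻¹) = l * (2 * R) - R * (l * l⁻¹) := by ring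
      rw [e, hi] at this
      linarith
  have hR'R : R' < R := by
    have : R < R / l := by rw [lt_div_iff₀ hl0]; nlinarith
    simp only [hR']; linarith
  obtain ⟨B, hB⟩ : ∃ B, ∀ z : EuclideanSpace ℝ (Fin N), ‖z‖ ≤ R' → u z ≤ B := by
    have hsubset : Metric.closedBall (0 : EuclideanSpace ℝ (Fin N)) R' ⊆ Metric.ball 0 R :=
      Metric.closedBall_subset_ball hR'R
    obtain ⟨B, hB⟩ := (isCompact_closedBall (0 : EuclideanSpace ℝ (Fin N)) R').bddAbove_image
      (hu.contDiffOn.continuousOn.mono hsubset)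
    exact ⟨B, fun z hz => hB ⟨z, by simpa using hz, rfl⟩⟩
  set T := max B t₁ with hT
  have hbT : b < T := ht₁.trans_le (le_max_right _ _)
  have hfar : ∀ s, r₂ t₁ ≤ s → ρ s < R → r T ≤ ρ s → B ≤ φ s := fun s h1 h2 h3 => by
    obtain ⟨t₀, τ, σ, h4, -, h5, h6, h7, h8, h9⟩ := hpar s h1 h2
    rw [hval h4 h5 h6 h7 h8 h9]
    rw [← h7, h.strictMonoOn.le_iff_le hbT ((h4.trans h5).trans h6)] at h3
    have : 0 ≤ A * (τ - σ) := mul_nonneg hA (by linarith)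
    linarith [le_max_left B t₁]
  set C : Set (EuclideanSpace ℝ (Fin N)) :=
    {y | y ∈ Metric.closedBall 0 R' ∧ (r₂ t₁ ≤ ‖y‖ ∧ ρ ‖y‖ ≤ r T)} with hC
  have hCc : IsCompact C := by
    refine (isCompact_closedBall 0 R').inter_right (IsClosed.inter ?_ ?_)
    · exact isClosed_le (f := fun _ => r₂ t₁) (g := fun y => ‖y‖) continuous_const (by fun_prop)
    · exact isClosed_le (f := fun y => ρ ‖y‖) (g := fun _ => r T)
        (by simp only [hρ]; fun_prop) continuous_const
  have hCR : ∀ y ∈ C, ρ ‖y‖ < R := fun y hy => hy.2.2.trans_lt (h.r_lt hbT)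
  have hcont : ContinuousOn (fun y => u y - φ ‖y‖) C := fun y hy => by
    obtain ⟨t₀, τ, σ, h4, -, h5, h6, h7, h8, h9⟩ := hpar ‖y‖ hy.2.1 (hCR y hy)
    have c1 : ContinuousAt V (ρ ‖y‖) := by
      rw [← h7]; exact h.continuousAt_profile ((h4.trans h5).trans h6)
    have c2 : ContinuousAt V ‖y‖ := by
      rw [← h8]; exact h.continuousAt_profile (h4.trans h5)
    have c3 : ContinuousAt V₂ ‖y‖ := by
      rw [← h9]; exact h₂.continuousAt_profile h4
    have cn : ContinuousAt (fun y : EuclideanSpace ℝ (Fin N) => ‖y‖) y := by fun_prop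
    have cr : ContinuousAt (fun y : EuclideanSpace ℝ (Fin N) => ρ ‖y‖) y :=
      Continuous.continuousAt (by simp only [hρ]; fun_prop)
    have d1 := ContinuousAt.comp (g := V) (f := fun y : EuclideanSpace ℝ (Fin N) => ρ ‖y‖) c1 cr
    have d2 := ContinuousAt.comp (g := V) (f := fun y : EuclideanSpace ℝ (Fin N) => ‖y‖) c2 cn
    have d3 := ContinuousAt.comp (g := V₂) (f := fun y : EuclideanSpace ℝ (Fin N) => ‖y‖) c3 cn
    exact ((hu.contDiffAt (hsR _ (hCR y hy))).continuousAt.sub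
      (d1.add ((d2.sub d3).const_mul A))).continuousWithinAt
  have hxC : x ∈ C := by
    refine ⟨by simpa using (hρR' ‖x‖).1 hxR.le, hx, ?_⟩
    by_contra! hc
    have h1 := hfar ‖x‖ hx hxR hc.le
    have h2 := hB x ((hρR' ‖x‖).1 hxR.le)
    exact absurd (h2.trans h1) (not_le.2 hneg)
  obtain ⟨y, hyC, hymax⟩ := hCc.exists_isMaxOn ⟨x, hxC⟩ hcont
  have hyρ := hCR y hyC
  have hyR := hsR _ hyρ
  have hypos : 0 < u y - φ ‖y‖ :=
    lt_of_lt_of_le (by simp only [hφ]; linarith : 0 < u x - φ ‖x‖) (hymax hxC)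
  obtain ⟨t₀, τ, σ, h4, h4', h5, h6, h7, h8, h9⟩ := hpar ‖y‖ hyC.2.1 hyρ
  have hφy := hval h4 h5 h6 h7 h8 h9
  have hbτ : b < τ := h4.trans h5
  have hbt₀ : b < t₀ := hbτ.trans h6
  have hy1 : r₂ t₁ < ‖y‖ := by
    refine lt_of_le_of_ne hyC.2.1 fun he => ?_
    have e1 := hub y he.symm
    have e2 : V ‖y‖ ≤ V (ρ ‖y‖) := by
      have v1 : V (r t₀) = t₀ := h.profile_apply hbt₀
      have v2 : V (r τ) = τ := h.profile_apply hbτ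
      rw [← h7, v1, ← h8, v2]
      exact h6.le
    rw [he] at e1
    simp only [hφ] at hypos
    linarith
  have hy2 : ρ ‖y‖ < r T := by
    refine lt_of_le_of_ne hyC.2.2 fun he => ?_
    have e1 := hfar ‖y‖ hyC.2.1 hyρ he.ge
    have e2 := hB y ((hρR' ‖y‖).1 hyρ.le)
    linarith
  have hy0' : 0 < ‖y‖ := (h₂.r_pos t₁ ht₁).trans hy1
  have hy0 : y ≠ 0 := norm_pos_iff.1 hy0'
  have hloc : IsLocalMin (fun z => (-u) z - -φ ‖z - 0‖) y := by
    have e1 : ∀ᶠ z in 𝓝 y, r₂ t₁ < ‖z‖ :=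
      continuousAt_const.eventually_lt (show ContinuousAt (fun z => ‖z‖) y by fun_prop) hy1
    have e2 : ∀ᶠ z in 𝓝 y, ρ ‖z‖ < r T :=
      (show ContinuousAt (fun z => ρ ‖z‖) y by simp only [hρ]; fun_prop).eventually_lt
        continuousAt_const hy2
    filter_upwards [e1, e2] with z e1 e2
    have hz : z ∈ C := by
      refine ⟨?_, e1.le, e2.le⟩
      simpa using (hρR' ‖z‖).1 (e2.trans (h.r_lt hbT)).le
    have : u z - φ ‖z‖ ≤ u y - φ ‖y‖ := hymax hz
    simp only [sub_zero, Pi.neg_apply]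
    linarith
  obtain ⟨d1, d2⟩ := h.hasDerivAt_profile_dilation (s := ‖y - 0‖) (l := l) hbt₀
    (by rw [sub_zero]; exact h7.symm)
  have d3 := h.hasDerivAt_profile_eventually hbτ
  have d4 := h.hasDerivAt_slope hbτ
  have d5 := h₂.hasDerivAt_profile_eventually h4
  have d6 := h₂.hasDerivAt_slope h4
  rw [h8, ← sub_zero y] at d3 d4
  rw [h9, ← sub_zero y] at d5 d6
  have key := radial_le_laplacian_of_isLocalMin hN (hu.contDiffAt hyR).neg hy0
    (φ := fun s => -φ s)
    (φ1 := fun s => -(l * p (V (ρ s)) + A * (p (V s) - p₂ (V₂ s))))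
    (by
      filter_upwards [d1, d3, d5] with s d1 d3 d5
      exact (d1.add ((d3.sub d5).const_mul A)).neg)
    (d2.add ((d4.sub d6).const_mul A)).neg hloc
  change _ ≤ (Δ (-u)) y at key
  rw [sub_zero, InnerProductSpace.laplacian_neg, Pi.neg_apply, hu.laplacian_eq hyR] at key
  have e1 : V (ρ ‖y‖) = t₀ := by rw [← h7, hV, h.profile_apply hbt₀]
  have e2 : V ‖y‖ = τ := by rw [← h8, hV, h.profile_apply hbτ]
  have e3 : V₂ ‖y‖ = σ := by rw [← h9, hV₂, h₂.profile_apply h4]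
  simp only [e1, e2, e3] at key
  rw [hφy] at hypos
  have hAτ : 0 ≤ A * (τ - σ) := mul_nonneg hA (by linarith)
  have hlt : g (t₀ + A * (τ - σ)) < g (u y) :=
    hmono (mem_Ici.2 (by linarith)) (mem_Ici.2 (by linarith)) (by linarith)
  have hcv := hconv.add_mul_sub_le hA (hab.trans h4.le) h5.le h6.le
  have hrt := h.r_pos t₀ hbt₀
  -- at the maximum of `u - φ` this yields `g u = Δu ≤ Δφ ≤ g φ < g u`
  have herr := dilation_error_le hR hN1 hl0 (h.p_pos t₀ hbt₀).le hκ (hg t₀ hbt₀)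
    (hhalf t₀ hbt₀) ((hhalf τ hbτ).trans h8.le)
  have hs₀ := mul_le_mul_of_nonneg_left (hsup t₀ hbt₀) (by positivity : 0 ≤ l ^ 2)
  have hsτ := hsup τ hbτ
  have hsσ := hsub σ h4
  rw [h8] at hsτ
  rw [h9] at hsσ
  have hdiff := mul_le_mul_of_nonneg_left (sub_le_sub hsτ hsσ) hA
  have e4 : (N - 1) * (l * p t₀ / ‖y‖) - l ^ 2 * (((N : ℝ) - 1) * (p t₀ / r t₀)) =
      (1 - l) * ((N - 1) * l * p t₀ * (2 * R) / (r t₀ * ‖y‖)) := by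
    have : 2 * R * (l - 1) = l * ‖y‖ - r t₀ := by rw [h7]; simp only [hρ]; ring
    field_simp
    linear_combination (N - 1 : ℝ) * p t₀ * this
  have e5 := mul_le_mul_of_nonneg_left herr (by linarith : 0 ≤ 1 - l)
  have e6 : -(l * (p' t₀ * p t₀ * l) + A * (p' τ * p τ - p₂' σ * p₂ σ)) +
      ((N : ℝ) - 1) * (-(l * p t₀ + A * (p τ - p₂ σ)) / ‖y‖) =
      -(l ^ 2 * (p' t₀ * p t₀) + (N - 1) * (l * p t₀ / ‖y‖) +
        A * (p' τ * p τ + (N - 1) * (p τ / ‖y‖) - (p₂' σ * p₂ σ + (N - 1) * (p₂ σ / ‖y‖)))) := by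
    ring
  rw [e6] at key
  have e7 : (1 - l) * ((1 + l) * g t₀) = g t₀ - l ^ 2 * g t₀ := by ring
  rw [e7, ← e4] at e5
  rw [mul_add] at hs₀
  rw [mul_sub A (g τ)] at hdiff
  rw [mul_sub A (g τ)] at hcv
  linarith

/-- A large solution stays below a supersolution `V` that blows up on the boundary, up to a multiple
of the difference of `V` and a smaller subsolution. -/
theorem le_profile (hN : 0 < N) (hR : 0 < R) (hab : a ≤ b)
    (hconv : ConvexOn ℝ (Ici a) g) (hmono : StrictMonoOn g (Ici b))
    (hu : IsLargeSolution g R u) (h : IsPhaseCurve R b r p p') (h₂ : IsPhaseCurve R b r₂ p₂ p₂')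
    (hsup : ∀ t > b, p' t * p t + (N - 1) * (p t / r t) ≤ g t)
    (hsub : ∀ t > b, g t ≤ p₂' t * p₂ t + (N - 1) * (p₂ t / r₂ t))
    (hrr : ∀ t > b, r t < r₂ t) (hhalf : ∀ t > b, R / 2 ≤ r t)
    (hκ : 8 * ((N : ℝ) - 1) / R ≤ κ) (hg : ∀ t > b, κ * p t ≤ g t) {t₁ : ℝ} (ht₁ : b < t₁) :
    ∃ A ≥ 0, ∀ x : EuclideanSpace ℝ (Fin N), ‖x‖ < R → r₂ t₁ ≤ ‖x‖ →
      u x ≤ radialProfile b r ‖x‖ + A * (radialProfile b r ‖x‖ - radialProfile b r₂ ‖x‖) := by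
  obtain ⟨B, hB⟩ : ∃ B, ∀ z : EuclideanSpace ℝ (Fin N), ‖z‖ = r₂ t₁ → u z ≤ B := by
    have hsubset : Metric.sphere (0 : EuclideanSpace ℝ (Fin N)) (r₂ t₁) ⊆ Metric.ball 0 R :=
      Metric.sphere_subset_closedBall.trans (Metric.closedBall_subset_ball (h₂.r_lt ht₁))
    obtain ⟨B, hB⟩ := (isCompact_sphere (0 : EuclideanSpace ℝ (Fin N)) (r₂ t₁)).bddAbove_image
      (hu.contDiffOn.continuousOn.mono hsubset)
    exact ⟨B, fun z hz => hB ⟨z, by simpa using hz, rfl⟩⟩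
  obtain ⟨s₁, hs₁, hs₁'⟩ := profile_lt_profile h h₂ hrr ht₁
  have e1 : radialProfile b r (r₂ t₁) = s₁ := by rw [← hs₁', h.profile_apply (ht₁.trans hs₁)]
  have e2 : radialProfile b r₂ (r₂ t₁) = t₁ := h₂.profile_apply ht₁
  have hd : 0 < s₁ - t₁ := sub_pos.2 hs₁
  set A := max 0 ((B - s₁) / (s₁ - t₁)) with hA
  have hA0 : 0 ≤ A := le_max_left _ _
  refine ⟨A, hA0, fun x hx hxr => ?_⟩
  have hub : ∀ x : EuclideanSpace ℝ (Fin N), ‖x‖ = r₂ t₁ → u x ≤ radialProfile b r (r₂ t₁) +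
      A * (radialProfile b r (r₂ t₁) - radialProfile b r₂ (r₂ t₁)) := fun x hx => by
    rw [e1, e2]
    have h1 := hB x hx
    have h2 := (div_le_iff₀ hd).1 (le_max_right 0 ((B - s₁) / (s₁ - t₁)))
    linarith
  obtain ⟨σ, hσ, hσ'⟩ := h₂.exists_eq ht₁ hxr hx
  obtain ⟨τ, hτ, hτ'⟩ := profile_lt_profile h h₂ hrr (ht₁.trans_le hσ)
  have h1 := h.tendsto_profile_dilation ((ht₁.trans_le hσ).trans hτ)
  rw [hτ', hσ'] at h1
  refine ge_of_tendsto ((h1.add_const _).mono_left (nhdsWithin_le_nhds (s := Iio 1))) ?_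
  have h4 : ∀ᶠ l in 𝓝 (1 : ℝ), 2 * R - l * (2 * R - ‖x‖) < R :=
    (show ContinuousAt (fun l : ℝ => 2 * R - l * (2 * R - ‖x‖)) 1 by fun_prop).eventually_lt
      continuousAt_const (by rwa [one_mul, sub_sub_cancel])
  filter_upwards [self_mem_nhdsWithin, h4.filter_mono nhdsWithin_le_nhds,
    (lt_mem_nhds one_pos).filter_mono nhdsWithin_le_nhds] with l hl hl' hl0
  exact le_profile_dilation hN hR hab hconv hmono hu h h₂ hsup hsub hrr hhalf hκ hg ht₁ hA0 hub
    hl0 hl hxr hl'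

end Comparison

/-! ### A family of subsolutions asymptotic to a solution -/

theorem nonneg_of_deriv_nonpos_of_tendsto {f f' : ℝ → ℝ} {b : ℝ}
    (hd : ∀ t > b, HasDerivAt f (f' t) t) (hn : ∀ t > b, f' t ≤ 0)
    (hf : Tendsto f atTop (𝓝 0)) {t : ℝ} (ht : b < t) : 0 ≤ f t := by
  have hanti : AntitoneOn f (Ioi b) := by
    refine antitoneOn_of_deriv_nonpos (convex_Ioi b)
      (fun t ht => (hd t ht).continuousAt.continuousWithinAt)
      (fun t ht => ?_) fun t ht => ?_
    · rw [interior_Ioi] at ht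
      exact (hd t ht).differentiableAt.differentiableWithinAt
    · rw [interior_Ioi] at ht
      rw [(hd t ht).deriv]
      exact hn t ht
  refine le_of_tendsto hf ?_
  filter_upwards [eventually_ge_atTop t] with s hs
  exact hanti (mem_Ioi.2 ht) (mem_Ioi.2 (ht.trans_le hs)) hs

/-- The slope of the profile whose kinetic energy `p² / 2` is increased by `E / 2`. -/
noncomputable def raisedSlope (E : ℝ) (p : ℝ → ℝ) (t : ℝ) : ℝ :=
  √(p t ^ 2 + E)

/-- The radius function of the profile with slope `raisedSlope E p`. -/
noncomputable def raisedRadius (R E : ℝ) (p : ℝ → ℝ) (t : ℝ) : ℝ :=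
  R - ∫ s in Ioi t, 1 / raisedSlope E p s

namespace IsPhaseCurve

variable {R b E : ℝ} {r p p' : ℝ → ℝ}

theorem lt_raisedSlope (hE : 0 < E) (p : ℝ → ℝ) (t : ℝ) :
    p t < raisedSlope E p t :=
  Real.lt_sqrt_of_sq_lt (by linarith)

theorem raisedSlope_pos (hE : 0 < E) (p : ℝ → ℝ) (t : ℝ) : 0 < raisedSlope E p t :=
  Real.sqrt_pos.2 (by positivity)

theorem hasDerivAt_raisedSlope (h : IsPhaseCurve R b r p p') (hE : 0 < E) {t : ℝ} (ht : b < t) :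
    HasDerivAt (raisedSlope E p) (p t * p' t / raisedSlope E p t) t := by
  have h1 := (((h.hasDerivAt_p t ht).pow 2).add_const E).sqrt
    (show p t ^ 2 + E ≠ 0 by positivity)
  refine h1.congr_deriv ?_
  rw [raisedSlope]
  push_cast
  field_simp
  exact mul_div_cancel_right₀ _ (Real.sqrt_pos.2 (by positivity)).ne'

theorem continuousOn_raisedSlope (h : IsPhaseCurve R b r p p') (hE : 0 < E) :
    ContinuousOn (fun t => 1 / raisedSlope E p t) (Ioi b) := fun t ht =>
  (continuousAt_const.div (h.hasDerivAt_raisedSlope hE ht).continuousAt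
    (raisedSlope_pos hE p t).ne').continuousWithinAt

theorem integrableOn_raisedSlope (h : IsPhaseCurve R b r p p') (hE : 0 < E)
    (hint : IntegrableOn (fun t => 1 / p t) (Ioi b)) :
    IntegrableOn (fun t => 1 / raisedSlope E p t) (Ioi b) := by
  refine Integrable.mono' hint
    ((h.continuousOn_raisedSlope hE).aestronglyMeasurable measurableSet_Ioi) ?_
  refine (ae_restrict_iff' measurableSet_Ioi).2 (.of_forall fun t ht => ?_)
  rw [Real.norm_of_nonneg (one_div_nonneg.2 (raisedSlope_pos hE p _).le)]
  exact one_div_le_one_div_of_le (h.p_pos t ht) (lt_raisedSlope hE p t).le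

theorem hasDerivAt_raisedRadius (h : IsPhaseCurve R b r p p') (hE : 0 < E)
    (hint : IntegrableOn (fun t => 1 / p t) (Ioi b)) {t : ℝ} (ht : b < t) :
    HasDerivAt (raisedRadius R E p) (1 / raisedSlope E p t) t := by
  have := (hasDerivAt_integral_Ioi (h.continuousOn_raisedSlope hE)
    (h.integrableOn_raisedSlope hE hint) ht).const_sub R
  rwa [neg_neg] at this

theorem tendsto_raisedRadius (R E : ℝ) (p : ℝ → ℝ) : Tendsto (raisedRadius R E p) atTop (𝓝 R) := by
  have h1 : Tendsto (fun t => R - ∫ s in Ioi t, 1 / raisedSlope E p s) atTop (𝓝 (R - 0)) :=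
    (tendsto_integral_Ioi_zero tendsto_id).const_sub R
  rwa [sub_zero] at h1

theorem lt_raisedRadius (h : IsPhaseCurve R b r p p') (hE : 0 < E)
    (hint : IntegrableOn (fun t => 1 / p t) (Ioi b)) {t : ℝ} (ht : b < t) :
    r t < raisedRadius R E p t := by
  have hd : ∀ t > b, HasDerivAt (fun t => raisedRadius R E p t - r t)
      (1 / raisedSlope E p t - 1 / p t) t := fun t ht =>
    (h.hasDerivAt_raisedRadius hE hint ht).sub (h.hasDerivAt_r t ht)
  have hn : ∀ t > b, 1 / raisedSlope E p t - 1 / p t < 0 := fun t ht =>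
    sub_neg.2 (one_div_lt_one_div_of_lt (h.p_pos t ht) (lt_raisedSlope hE p t))
  have h0 := nonneg_of_deriv_nonpos_of_tendsto hd (fun t ht => (hn t ht).le)
    (by simpa using (tendsto_raisedRadius R E p).sub h.tendsto) (t := t + 1) (by linarith)
  have hanti : StrictAntiOn (fun t => raisedRadius R E p t - r t) (Ioi b) := by
    refine strictAntiOn_of_deriv_neg (convex_Ioi b)
      (fun t ht => (hd t ht).continuousAt.continuousWithinAt) fun t ht => ?_
    rw [interior_Ioi] at ht
    rw [(hd t ht).deriv]
    exact hn t ht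
  have := hanti (mem_Ioi.2 ht) (mem_Ioi.2 (by linarith : b < t + 1)) (lt_add_one t)
  simp only at this
  linarith

theorem raised (h : IsPhaseCurve R b r p p') (hE : 0 < E)
    (hint : IntegrableOn (fun t => 1 / p t) (Ioi b)) :
    IsPhaseCurve R b (raisedRadius R E p) (raisedSlope E p)
      (fun t => p t * p' t / raisedSlope E p t) where
  r_pos t ht := (h.r_pos t ht).trans (h.lt_raisedRadius hE hint ht)
  p_pos t _ := raisedSlope_pos hE p t
  hasDerivAt_r _ ht := h.hasDerivAt_raisedRadius hE hint ht
  hasDerivAt_p _ ht := h.hasDerivAt_raisedSlope hE ht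
  tendsto := tendsto_raisedRadius R E p

/-- Raising the energy increases the drag term: `p / r ≤ p₂ / r₂`. The difference
`(1 - p / p₂) (R - r) - (r₂ - r)` decreases to `0`. -/
theorem div_le_raised_div (h : IsPhaseCurve R b r p p') (hE : 0 < E)
    (hint : IntegrableOn (fun t => 1 / p t) (Ioi b)) (hp' : ∀ t > b, 0 ≤ p' t)
    (hhalf : ∀ t > b, R / 2 ≤ r t) {t : ℝ} (ht : b < t) :
    p t / r t ≤ raisedSlope E p t / raisedRadius R E p t := by
  set q := raisedSlope E p with hq
  set ρ := raisedRadius R E p with hρ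
  have hqpos : ∀ t, 0 < q t := raisedSlope_pos hE p
  have hqsq : ∀ t, q t ^ 2 = p t ^ 2 + E := fun t => Real.sq_sqrt (by positivity)
  have hd : ∀ t > b, HasDerivAt (fun t => (1 - p t / q t) * (R - r t) - (ρ t - r t))
      (-(p' t * E / q t ^ 3) * (R - r t)) t := fun t ht => by
    have h1 := (h.hasDerivAt_p t ht).div (h.hasDerivAt_raisedSlope hE ht) (hqpos t).ne'
    have h2 := ((h1.const_sub 1).mul ((h.hasDerivAt_r t ht).const_sub R)).sub
      ((h.hasDerivAt_raisedRadius hE hint ht).sub (h.hasDerivAt_r t ht))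
    refine h2.congr_deriv ?_
    have hpt := h.p_pos t ht
    have hqt := hqpos t
    have hE' : E = q t ^ 2 - p t ^ 2 := by rw [hqsq]; ring
    change -((p' t * q t - p t * (p t * p' t / q t)) / q t ^ 2) * (R - r t) +
      (1 - p t / q t) * -(1 / p t) - (1 / q t - 1 / p t) = _
    rw [hE']
    field_simp
    ring
  have hpq : ∀ t > b, 0 ≤ 1 - p t / q t ∧ 1 - p t / q t ≤ 1 := fun t ht => by
    have h1 : p t / q t ≤ 1 := (div_le_one (hqpos t)).2 (lt_raisedSlope hE p t).le
    have h2 : 0 ≤ p t / q t := div_nonneg (h.p_pos t ht).le (hqpos t).le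
    constructor <;> linarith
  have hlim : Tendsto (fun t => (1 - p t / q t) * (R - r t) - (ρ t - r t)) atTop (𝓝 0) := by
    have h1 : Tendsto (fun t => R - r t) atTop (𝓝 0) := by
      simpa using h.tendsto.const_sub R
    have h2 : Tendsto (fun t => (1 - p t / q t) * (R - r t)) atTop (𝓝 0) := by
      refine squeeze_zero' ?_ ?_ h1
      · filter_upwards [eventually_gt_atTop b] with t ht
        exact mul_nonneg (hpq t ht).1 (by linarith [h.r_lt ht])
      · filter_upwards [eventually_gt_atTop b] with t ht
        exact mul_le_of_le_one_left (by linarith [h.r_lt ht]) (hpq t ht).2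
    simpa using h2.sub ((tendsto_raisedRadius R E p).sub h.tendsto)
  have key := nonneg_of_deriv_nonpos_of_tendsto hd (fun t ht => by
    have h1 : 0 ≤ p' t * E / q t ^ 3 :=
      div_nonneg (mul_nonneg (hp' t ht) hE.le) (pow_pos (hqpos t) 3).le
    have h2 : 0 ≤ R - r t := by linarith [h.r_lt ht]
    nlinarith [mul_nonneg h1 h2]) hlim ht
  have hpt := h.p_pos t ht
  have hrt := h.r_pos t ht
  have hqt := hqpos t
  have hρt : 0 < ρ t := (h.raised hE hint).r_pos t ht
  have hlt : p t < q t := lt_raisedSlope hE p t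
  -- `ρ - r ≤ (1 - p / q) r`, since `R - r ≤ r`
  have h1 : ρ t - r t ≤ (1 - p t / q t) * r t := by
    have : (1 - p t / q t) * (R - r t) ≤ (1 - p t / q t) * r t :=
      mul_le_mul_of_nonneg_left (by linarith [hhalf t ht]) (hpq t ht).1
    linarith
  rw [div_le_div_iff₀ hrt hρt]
  have h2 : q t * (ρ t - r t) ≤ (q t - p t) * r t := by
    calc q t * (ρ t - r t) ≤ q t * ((1 - p t / q t) * r t) := by gcongr
      _ = (q t - p t) * r t := by field_simp
  have h3 : 0 < ρ t - r t := sub_pos.2 (h.lt_raisedRadius hE hint ht)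
  have h4 : p t * (ρ t - r t) ≤ q t * (ρ t - r t) := by gcongr
  nlinarith

/-- As the energy tends to infinity, the profile starts arbitrarily close to the boundary. -/
theorem exists_lt_raisedRadius (h : IsPhaseCurve R b r p p')
    (hint : IntegrableOn (fun t => 1 / p t) (Ioi b)) {t ρ : ℝ} (ht : b < t) (hρ : ρ < R) :
    ∃ E > 0, ρ < raisedRadius R E p t := by
  have hlim : Tendsto (fun E => ∫ s in Ioi t, 1 / raisedSlope E p s) atTop
      (𝓝 (∫ _ in Ioi t, (0 : ℝ))) := by
    refine tendsto_integral_filter_of_dominated_convergence (fun s => 1 / p s) ?_ ?_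
      (hint.mono_set (Ioi_subset_Ioi ht.le)) (.of_forall fun s => ?_)
    · filter_upwards [eventually_gt_atTop 0] with E hE
      exact ((h.continuousOn_raisedSlope hE).mono
        (Ioi_subset_Ioi ht.le)).aestronglyMeasurable measurableSet_Ioi
    · filter_upwards [eventually_gt_atTop 0] with E hE
      refine (ae_restrict_iff' measurableSet_Ioi).2 (.of_forall fun s hs => ?_)
      rw [Real.norm_of_nonneg (one_div_nonneg.2 (raisedSlope_pos hE p _).le)]
      exact one_div_le_one_div_of_le (h.p_pos s (ht.trans hs)) (lt_raisedSlope hE p s).le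
    · have h1 : Tendsto (fun E => raisedSlope E p s) atTop atTop :=
        Real.tendsto_sqrt_atTop.comp (tendsto_atTop_add_const_left _ _ tendsto_id)
      simp only [one_div]
      exact h1.inv_tendsto_atTop
  rw [integral_zero] at hlim
  obtain ⟨E, hE1, hE2⟩ := ((hlim.eventually (gt_mem_nhds (sub_pos.2 hρ))).and
    (eventually_gt_atTop 0)).exists
  exact ⟨E, hE2, by rw [raisedRadius]; linarith⟩

/-- The profiles before and after raising the energy have difference tending to `0`, as soon as the
derivative of `p²` tends to infinity. -/
theorem eventually_raisedRadius_le (h : IsPhaseCurve R b r p p') (hE : 0 < E)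
    (hint : IntegrableOn (fun t => 1 / p t) (Ioi b))
    (hpp : Tendsto (fun t => p' t * p t) atTop atTop) {ε : ℝ} (hε : 0 < ε) :
    ∃ T > b, ∀ t > T, raisedRadius R E p t ≤ r (t + ε) := by
  obtain ⟨T, hT⟩ := eventually_atTop.1 (hpp.eventually_ge_atTop (E / (2 * ε)))
  refine ⟨max T b + 1, by linarith [le_max_right T b], fun t ht => ?_⟩
  have hTb : b < max T b + 1 := by linarith [le_max_right T b]
  have hTT : T < max T b + 1 := by linarith [le_max_left T b]
  -- `p²` grows by at least `E` over every interval of length `ε`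
  have hgrow : ∀ t > max T b + 1, raisedSlope E p t ≤ p (t + ε) := fun t ht => by
    have hmono : MonotoneOn (fun s => p s ^ 2 - E / ε * s) (Ici t) := by
      have hd : ∀ s ∈ Ici t, HasDerivAt (fun s => p s ^ 2 - E / ε * s)
          (2 * (p' s * p s) - E / ε) s := fun s hs => by
        have hs' : b < s := by linarith [mem_Ici.1 hs]
        refine (((h.hasDerivAt_p s hs').pow 2).sub
          ((hasDerivAt_id s).const_mul (E / ε))).congr_deriv ?_
        push_cast; ring
      refine monotoneOn_of_deriv_nonneg (convex_Ici t)
        (fun s hs => (hd s hs).continuousAt.continuousWithinAt)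
        (fun s hs => (hd s (interior_subset hs)).differentiableAt.differentiableWithinAt)
        fun s hs => ?_
      rw [(hd s (interior_subset hs)).deriv]
      have h1 := hT s (by linarith [mem_Ici.1 (interior_subset hs)])
      have h2 : E / (2 * ε) = E / ε / 2 := by field_simp
      linarith
    have h1 := hmono self_mem_Ici (mem_Ici.2 (by linarith : t ≤ t + ε)) (by linarith)
    simp only at h1
    have h2 : E / ε * (t + ε) = E / ε * t + E := by field_simp
    exact Real.sqrt_le_iff.2 ⟨(h.p_pos _ (by linarith)).le, by linarith⟩
  have hlim : Tendsto (fun t => r (t + ε)) atTop (𝓝 R) :=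
    h.tendsto.comp (tendsto_atTop_add_const_right _ ε tendsto_id)
  have key := nonneg_of_deriv_nonpos_of_tendsto
    (f := fun t => r (t + ε) - raisedRadius R E p t)
    (f' := fun t => 1 / p (t + ε) - 1 / raisedSlope E p t) (b := max T b + 1)
    (fun t ht => ((h.hasDerivAt_r (t + ε) (by linarith)).comp_add_const t ε).sub
      (h.hasDerivAt_raisedRadius hE hint (by linarith)))
    (fun t ht => sub_nonpos.2 (one_div_le_one_div_of_le (raisedSlope_pos hE p t) (hgrow t ht)))
    (by simpa using hlim.sub (tendsto_raisedRadius R E p)) ht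
  linarith

end IsPhaseCurve

/-! ### Boundary behaviour of large solutions -/

section Boundary

variable {N : ℕ} {g : ℝ → ℝ} {R a : ℝ} {u : EuclideanSpace ℝ (Fin N) → ℝ}

/-- Near the boundary a large solution differs from one radial solution by an error tending to `0`;
hence it is almost monotone in `|x|`. -/
theorem almostRadiallyMonotone (hN : 0 < N) (hR : 0 < R) (hg : Continuous g)
    (hpos : ∀ s ∈ Ici a, 0 < g s) (hconv : ConvexOn ℝ (Ici a) g) (hKO : KellerOsserman g a)
    (hu : IsLargeSolution g R u) : AlmostRadiallyMonotone R u := by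
  have hN1 : (1 : ℝ) ≤ N := by exact_mod_cast hN
  have hcast : ((N - 1 : ℕ) : ℝ) = (N : ℝ) - 1 := by rw [Nat.cast_sub hN, Nat.cast_one]
  obtain ⟨b₀, hab₀, -, hmono₀⟩ := exists_strictMonoOn_Ici hg hpos hconv hKO
  set κ : ℝ := 8 * N / R with hκdef
  have hκ0 : 0 ≤ κ := by positivity
  have hκ : 8 * ((N : ℝ) - 1) / R ≤ κ := by simp only [hκdef]; gcongr; linarith
  obtain ⟨b, ⟨r, p, h, hhalf, hgp, hint⟩, hb₀⟩ :=
    ((exists_phaseCurve hg hpos hconv hKO hR (N - 1) hκ0).and (eventually_ge_atTop b₀)).exists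
  have hab : a ≤ b := hab₀.le.trans hb₀
  have hmono : StrictMonoOn g (Ici b) := hmono₀.mono (Ici_subset_Ici.2 hb₀)
  set p' : ℝ → ℝ := fun t => g t / p t - ((N - 1 : ℕ) : ℝ) / r t with hp'
  -- the drag is at most a quarter of the force
  have hdrag4 : ∀ t > b, 4 * (((N : ℝ) - 1) * (p t / r t)) ≤ g t := fun t ht => by
    have hpt := h.p_pos t ht
    have h1 : p t / r t ≤ p t / (R / 2) :=
      div_le_div_of_nonneg_left hpt.le (by positivity) (hhalf t ht)
    have h2 : ((N : ℝ) - 1) * (p t / r t) ≤ N * (p t / (R / 2)) := by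
      have : 0 ≤ p t / r t := div_nonneg hpt.le (h.r_pos t ht).le
      gcongr
      linarith
    have h3 : (N : ℝ) * (p t / (R / 2)) = κ * p t / 4 := by
      simp only [hκdef]; field_simp; norm_num
    have h4 := hgp t ht
    linarith
  have hdrag : ∀ t > b, ((N : ℝ) - 1) * (p t / r t) ≤ g t / 2 := fun t ht => by
    linarith [hdrag4 t ht, hpos t (mem_Ici.2 (hab.trans (le_of_lt ht)))]
  have heq : ∀ t > b, p' t * p t + ((N : ℝ) - 1) * (p t / r t) = g t := fun t ht => by
    have hpt := (h.p_pos t ht).ne'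
    have hrt := (h.r_pos t ht).ne'
    simp only [hp', hcast]
    field_simp
    ring
  have hp'0 : ∀ t > b, 0 ≤ p' t := fun t ht => by
    have h1 := heq t ht
    have h2 := hdrag t ht
    have h3 := hpos t (mem_Ici.2 (hab.trans (le_of_lt ht)))
    have h4 : 0 ≤ p' t * p t := by linarith
    exact nonneg_of_mul_nonneg_left h4 (h.p_pos t ht)
  have hpp : Tendsto (fun t => p' t * p t) atTop atTop := by
    refine tendsto_atTop_mono' _ ?_
      ((tendsto_atTop_of_keller_osserman hg hpos hconv hKO).atTop_div_const (two_pos (α := ℝ)))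
    filter_upwards [eventually_gt_atTop b] with t ht
    have h1 := heq t ht
    have h2 := hdrag t ht
    linarith
  -- the energy is raised so much that the subsolution starts where `u` is already large
  obtain ⟨δ₁, hδ₁, hbl⟩ := hu.blowup (b + 1)
  obtain ⟨E, hE, hEr⟩ := h.exists_lt_raisedRadius hint (t := b + 1) (ρ := R - δ₁)
    (by linarith) (by linarith)
  have h₂ := h.raised hE hint
  set r₂ := raisedRadius R E p
  set p₂ := raisedSlope E p
  have hrr : ∀ t > b, r t < r₂ t := fun t ht => h.lt_raisedRadius hE hint ht
  have hsub : ∀ t > b, g t ≤ p t * p' t / p₂ t * p₂ t + ((N : ℝ) - 1) * (p t / r t) :=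
    fun t ht => by
      rw [div_mul_cancel₀ _ (h₂.p_pos t ht).ne', mul_comm (p t)]
      exact (heq t ht).ge
  have hdd : ∀ t > b, p t / r t ≤ p₂ t / r₂ t := fun t ht =>
    h.div_le_raised_div hE hint hp'0 hhalf ht
  -- the lower bound `V₂ ≤ u` and the upper bound `u ≤ V + A (V - V₂)`
  have hlow : ∀ x : EuclideanSpace ℝ (Fin N), ‖x‖ < R → r₂ (b + 1) < ‖x‖ →
      radialProfile b r₂ ‖x‖ ≤ u x := fun x hx hxb =>
    profile_le hN hR hmono hu h₂ hsub
      (fun t ht => (div_pos (h.p_pos t ht) (h.r_pos t ht)).le) hdd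
      hdrag4 (lt_add_one b)
      ((hhalf _ (lt_add_one b)).trans (hrr _ (lt_add_one b)).le)
      (fun y hy hy' => (hbl y (by simpa using hy) (by linarith)).le) hx hxb
  obtain ⟨A, hA, hup⟩ := le_profile hN hR hab hconv hmono hu h h₂ (fun t ht => (heq t ht).le)
    (fun t ht => (hsub t ht).trans (by
      have := mul_le_mul_of_nonneg_left (hdd t ht) (by linarith : 0 ≤ (N : ℝ) - 1)
      linarith)) hrr hhalf hκ hgp (lt_add_one b)
  set V := radialProfile b r
  set V₂ := radialProfile b r₂
  -- both bounds are within `ε` of `V` as soon as `V - V₂ ≤ ε / (1 + A)`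
  intro ε hε
  have hε' : 0 < ε / (1 + A) := by positivity
  obtain ⟨T, -, hT⟩ := h.eventually_raisedRadius_le hE hint hpp hε'
  set T' := max T (b + 1) with hT'
  have hbT : b < T' := by linarith [le_max_right T (b + 1)]
  have hpar : ∀ s, r₂ T' < s → s < R → ∃ σ τ, b < σ ∧ σ < τ ∧ τ ≤ σ + ε / (1 + A) ∧
      V₂ s = σ ∧ V s = τ ∧ r τ = s := fun s hs hsR => by
    obtain ⟨σ, hσ, hσ'⟩ := h₂.exists_eq hbT hs.le hsR
    have hσT : T' < σ := by
      refine lt_of_le_of_ne hσ ?_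
      rintro hc
      rw [← hc] at hσ'
      exact hs.ne hσ'
    have hbσ := hbT.trans hσT
    obtain ⟨τ, hτ, hτ'⟩ := profile_lt_profile h h₂ hrr hbσ
    refine ⟨σ, τ, hbσ, hτ, ?_, ?_, ?_, hτ'.trans hσ'⟩
    · refine (h.strictMonoOn.le_iff_le (hbσ.trans hτ) (mem_Ioi.2 (by linarith))).1 ?_
      rw [hτ']
      exact hT σ ((le_max_left _ _).trans_lt hσT)
    · rw [← hσ']; exact h₂.profile_apply hbσ
    · rw [← hσ', ← hτ']; exact h.profile_apply (hbσ.trans hτ)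
  -- a bound for `u` on the compact ball on which the profiles are not yet close
  obtain ⟨B, hB⟩ : ∃ B, ∀ z : EuclideanSpace ℝ (Fin N), ‖z‖ ≤ r₂ T' → u z ≤ B := by
    obtain ⟨B, hB⟩ := (isCompact_closedBall (0 : EuclideanSpace ℝ (Fin N)) (r₂ T')).bddAbove_image
      (hu.contDiffOn.continuousOn.mono (Metric.closedBall_subset_ball (h₂.r_lt hbT)))
    exact ⟨B, fun z hz => hB ⟨z, by simpa using hz, rfl⟩⟩
  obtain ⟨δ₂, hδ₂, hbl₂⟩ := hu.blowup B
  refine ⟨min δ₂ (R - r₂ T'), lt_min hδ₂ (sub_pos.2 (h₂.r_lt hbT)), fun x hx y hy hxδ hyx => ?_⟩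
  have hx1 : R - δ₂ < ‖x‖ := by linarith [min_le_left δ₂ (R - r₂ T')]
  have hx2 : r₂ T' < ‖x‖ := by linarith [min_le_right δ₂ (R - r₂ T')]
  have hxR : ‖x‖ < R := by simpa using hx
  rcases le_or_gt ‖y‖ (r₂ T') with hyT | hyT
  · linarith [hB y hyT, hbl₂ x hx hx1]
  have hyR : ‖y‖ < R := by simpa using hy
  have hbase : r₂ (b + 1) ≤ r₂ T' :=
    h₂.strictMonoOn.monotoneOn (mem_Ioi.2 (lt_add_one b)) hbT (le_max_right _ _)
  obtain ⟨σ, τ, hσ, hστ, hτσ, e1, e2, e3⟩ := hpar ‖x‖ hx2 hxR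
  obtain ⟨σ', τ', hσ', hστ', hτσ', e1', e2', e3'⟩ := hpar ‖y‖ hyT hyR
  have hlx := hlow x hxR (hbase.trans_lt hx2)
  have huy := hup y hyR (hbase.trans hyT.le)
  rw [e1] at hlx
  rw [e2', e1'] at huy
  have hττ : τ' ≤ τ := (h.strictMonoOn.le_iff_le (hσ'.trans hστ') (hσ.trans hστ)).1
    (by rw [e3, e3']; exact hyx)
  have h1 : A * (τ' - σ') ≤ A * (ε / (1 + A)) := mul_le_mul_of_nonneg_left (by linarith) hA
  have h2 : ε / (1 + A) + A * (ε / (1 + A)) = ε := by field_simp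
  linarith

end Boundary

/-! ### Symmetry and monotonicity -/

theorem mainTheorem1 (N : ℕ) (hN : 2 ≤ N) (R : ℝ) (hR : 0 < R)
    (g : ℝ → ℝ) (hg_lip : LocallyLipschitz g)
    (a : ℝ) (ha : 0 < a)
    (hg_pos : ∀ s ∈ Ici a, 0 < g s) (hg_convex : ConvexOn ℝ (Ici a) g)
    (hg_KO : KellerOsserman g a)
    (u : EuclideanSpace ℝ (Fin N) → ℝ) (hu : IsLargeSolution g R u) :
    IsRadialOnBall R u ∧
      ∀ x ∈ Metric.ball (0 : EuclideanSpace ℝ (Fin N)) R, x ≠ 0 → 0 < radialDeriv u x := by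
  have hN0 : 0 < N := by linarith
  have hg := hg_lip.continuous
  obtain ⟨b, -, -, hmono⟩ := exists_strictMonoOn_Ici hg hg_pos hg_convex hg_KO
  have hrad := almostRadiallyMonotone hN0 hR hg hg_pos hg_convex hg_KO hu
  exact ⟨isRadialOnBall_of_almostRadiallyMonotone hN0 hg_lip hmono hu hrad, fun x hx hx0 =>
    radialDeriv_pos_of_almostRadiallyMonotone hN0 hg_lip hmono hu hrad (by simpa using hx) hx0⟩
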